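/- **Setting.** Let $n,N\ge 0$. Let $X$ be a smooth $(n+1)$-manifold and $\pi_{XY}:Y\to X$ a smooth locally trivial fibre bundle with $N$-dimensional fibres, with vertical bundle $VY$. Let $J^1Y$ be the first jet bundle, whose elements over $y\in Y_x$ are the linear maps $\gamma:T_xX\to T_yY$ with $T\pi_{XY}\circ\gamma=\mathrm{id}$. Let $\mathcal L:J^1Y\to\Lambda^{n+1}X$ be a smooth bundle map over $X$ (a Lagrangian density). Let $\Sigma$ be a compact oriented $n$-manifold without boundary, $\tau:\Sigma\to X$ a smooth embedding, $\Sigma_\tau=\tau(\Sigma)$, with inclusion $i_\tau$ and the orientation of $\Sigma$, and $Y_\tau=Y|\Sigma_\tau$. Let $\zeta=\zeta_Y$ be a smooth vector field on $Y$ that projects to a smooth vector field $\zeta_X$ on $X$ everywhere transverse to $\Sigma_\tau$. **Multiphase space.** $Z\subset\Lambda^{n+1}Y$ is the set of $(n+1)$-forms $z\in\Lambda^{n+1}T^*_yY$ that vanish as soon as two of their arguments are vertical. $\Theta$ is the canonical $(n+1)$-form, $\Theta_z(u_1,\dots,u_{n+1})=z(T\pi\,u_1,\dots,T\pi\,u_{n+1})$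 with $\pi$ the projection to $Y$. The canonical lift $\zeta_Z$ of $\zeta_Y$ is the generator of the push-forward action on forms of the (local) flow of $\zeta_Y$. The covariant Legendre transformation $\mathbb F\mathcal L:J^1Y\to Z$ is determined by $$\gamma'^{*}\,\mathbb F\mathcal L(\gamma)=\mathcal L(\gamma)+\tfrac{d}{d\varepsilon}\big|_{0}\mathcal L\big(\gamma+\varepsilon(\gamma'-\gamma)\big)\qquad(\gamma,\gamma'\in J^1_yY).$$ **Instantaneous formalism.** $\mathcal Y_\tau$ is the set of smooth sections $\varphi$ of $Y_\tau\to\Sigma_\tau$. A tangent vector $\dot\varphi\in T_\varphi\mathcal Y_\tau$ is a smooth vertical vector field along $\varphi$. A point of $T^*\mathcal Y_\tau$ over $\varphi$ is a smooth field $\pi$ of linear maps $V_{\varphi(x)}Y\to\Lambda^nT^*_x\Sigma_\tau$. The jet decomposition sends the jet $\gamma=j^1\phi(x)$, $x\in\Sigma_\tau$, $y=\phi(x)$, to the pair $\big(\gamma|T_x\Sigma_\tau,\ \gamma(\zeta_X(x))-\zeta_Y(y)\big)$, i.e. to $(j^1\varphi,\dot\varphi)$ with $\varphi=\phi|\Sigma_\tau$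 and $\dot\varphi$ the Lie derivative of $\phi$ along $\zeta$. It is a bijection onto $J^1(Y_\tau)\times_{Y_\tau}VY_\tau$; let $\gamma(j^1\varphi,\dot\varphi)$ be its inverse and put $$\mathcal L_{\tau,\zeta}(j^1\varphi,\dot\varphi)=i_\tau^*\,i_{\zeta_X}\mathcal L\big(\gamma(j^1\varphi,\dot\varphi)\big),\qquad L_{\tau,\zeta}(\varphi,\dot\varphi)=\int_{\Sigma_\tau}\mathcal L_{\tau,\zeta}(j^1\varphi,\dot\varphi).$$ The instantaneous Legendre transformation is $\mathbb FL_{\tau,\zeta}(\varphi,\dot\varphi)=(\varphi,\pi)$ with $\pi=\partial\mathcal L_{\tau,\zeta}/\partial\dot\varphi$ (derivative along $VY_\tau$), and the primary constraint set $\mathcal P_\tau\subset T^*\mathcal Y_\tau$ is its image. Assume that the fibres of $\mathbb FL_{\tau,\zeta}$ are connected, in the sense that any two points of a fibre are joined by a smooth curve in that fibre. For $(\varphi,\pi)\in\mathcal P_\tau$ and any $\dot\varphi$ with $\mathbb FL_{\tau,\zeta}(\varphi,\dot\varphi)=(\varphi,\pi)$, the instantaneous Hamiltonian is $H_{\tau,\zeta}(\varphi,\pi)=\int_{\Sigma_\tau}\pi(\dot\varphi)-L_{\tau,\zeta}(\varphi,\dot\varphi)$,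 with density $\mathfrak h_{\tau,\zeta}(\varphi,\pi)=\pi(\dot\varphi)-\mathcal L_{\tau,\zeta}(j^1\varphi,\dot\varphi)$. **Holonomic lifts.** $\mathcal Z_\tau$ is the set of smooth sections of $Z$ over $\Sigma_\tau$. $\mathcal N_\tau\subset\mathcal Z_\tau$ consists of those of the form $\sigma=\mathbb F\mathcal L\circ j^1\phi\circ i_\tau$ for a smooth section $\phi$ of $Y\to X$. The map $R_\tau:\mathcal Z_\tau\to T^*\mathcal Y_\tau$ sends $\sigma$ to $(\varphi,\pi)$ with $\varphi$ the projection of $\sigma$ to $Y$ and $\pi(v)=\varphi^*(i_v\sigma)$. A holonomic lift of $(\varphi,\pi)$ is an element of $R_\tau^{-1}\{(\varphi,\pi)\}\cap\mathcal N_\tau$. **Proposition 6.5.** For every $(\varphi,\pi)\in\mathcal P_\tau$, the form $\mathfrak h_{\tau,\zeta}(\varphi,\pi)$ and the number $H_{\tau,\zeta}(\varphi,\pi)$ do not depend on the choice of $\dot\varphi$ whenever $(\varphi,\pi)$ has a holonomic lift, and for every holonomic lift $\sigma$ of $(\varphi,\pi)$ $$H_{\tau,\zeta}(\varphi,\pi)=-\int_{\Sigma_\tau}\sigma^*(i_{\zeta_Z}\Theta).$$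 The identity holds at the level of densities: $\mathfrak h_{\tau,\zeta}(\varphi,\pi)=-\sigma^*(i_{\zeta_Z}\Theta)$ at every point of $\Sigma_\tau$. -/

import Mathlib

open Bundle Set Filter
open scoped Manifold ContDiff Topology

noncomputable section

namespace FieldTheory

/-! ### Exterior forms on manifolds -/

/-- The model space `ℝᵈ`. -/
abbrev Model (d : ℕ) : Type := EuclideanSpace ℝ (Fin d)

/-- The interior product `i_v f`: the vector `v` is inserted in the first slot of `f`. -/
def interior {V : Type*} [AddCommGroup V] [Module ℝ V] [TopologicalSpace V] {k : ℕ}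
    (v : V) (f : V [⋀^Fin (k + 1)]→L[ℝ] ℝ) : V [⋀^Fin k]→L[ℝ] ℝ where
  toFun w := f (Matrix.vecCons v w)
  map_update_add' w i x y := (f.toAlternatingMap.curryLeft v).map_update_add w i x y
  map_update_smul' w i c x := (f.toAlternatingMap.curryLeft v).map_update_smul w i c x
  map_eq_zero_of_eq' w i j h hij := (f.toAlternatingMap.curryLeft v).map_eq_zero_of_eq w h hij
  cont := f.cont.comp (continuous_pi fun i => by
    refine Fin.cases ?_ (fun j => ?_) i
    · simpa using continuous_const
    · simpa using continuous_apply j)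

section
variable {V W : Type*} [NormedAddCommGroup V] [NormedSpace ℝ V]
  [NormedAddCommGroup W] [NormedSpace ℝ W] (k : ℕ)

theorem exists_leftInverse_toMultilinear :
    ∃ A : ContinuousMultilinearMap ℝ (fun _ : Fin k => V) ℝ →L[ℝ] (V [⋀^Fin k]→L[ℝ] ℝ),
      ∀ f : V [⋀^Fin k]→L[ℝ] ℝ, A f.toContinuousMultilinearMap = f := by
  let L : ContinuousMultilinearMap ℝ (fun _ : Fin k => V) ℝ →ₗ[ℝ] (V [⋀^Fin k]→L[ℝ] ℝ) :=
    { toFun f := f.alternatization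
      map_add' f g := map_add _ f g
      map_smul' c f := by
        ext v
        simp [ContinuousMultilinearMap.alternatization_apply_apply, Finset.mul_sum, mul_left_comm,
          Units.smul_def] }
  let B := L.mkContinuous (Fintype.card (Equiv.Perm (Fin k))) (fun f => by
    refine ContinuousAlternatingMap.opNorm_le_bound _ (by positivity) fun v => ?_
    change ‖f.alternatization v‖ ≤ _
    rw [ContinuousMultilinearMap.alternatization_apply_apply]
    refine (norm_sum_le _ _).trans ?_
    refine (Finset.sum_le_card_nsmul _ _ (‖f‖ * ∏ i, ‖v i‖) fun s _ => ?_).trans (le_of_eq ?_)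
    · have h := f.le_opNorm (v ∘ s)
      have h2 : ∏ i, ‖(v ∘ s) i‖ = ∏ i, ‖v i‖ := Equiv.prod_comp s (fun i => ‖v i‖)
      rw [h2] at h
      rcases Int.units_eq_one_or (Equiv.Perm.sign s) with h1 | h1 <;> rw [h1] <;> simpa using h
    · simp [mul_assoc])
  refine ⟨((k.factorial : ℝ)⁻¹) • B, fun f => ?_⟩
  ext v
  have h : f.toContinuousMultilinearMap.alternatization v = (k.factorial : ℝ) * f v := by
    rw [ContinuousMultilinearMap.alternatization_apply_apply]
    have := congrArg (fun g => g v) (AlternatingMap.coe_alternatization f.toAlternatingMap)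
    simpa [MultilinearMap.alternatization_apply, Function.comp_def] using this
  change ((k.factorial : ℝ)⁻¹) * f.toContinuousMultilinearMap.alternatization v = f v
  rw [h, inv_mul_cancel_left₀ (by positivity)]

/-- Pulling back alternating forms depends smoothly on the linear map. -/
theorem contDiff_compCLM : ContDiff ℝ ∞ (fun g : V →L[ℝ] W =>
      (ContinuousAlternatingMap.compContinuousLinearMapCLM g :
        (W [⋀^Fin k]→L[ℝ] ℝ) →L[ℝ] (V [⋀^Fin k]→L[ℝ] ℝ))) := by
  obtain ⟨A, hA⟩ := exists_leftInverse_toMultilinear (V := V) k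
  have h1 : ContDiff ℝ ∞ (fun g : V →L[ℝ] W =>
      ContinuousMultilinearMap.compContinuousLinearMapContinuousMultilinear ℝ
        (fun _ : Fin k => V) (fun _ => W) ℝ (fun _ => g)) :=
    (ContinuousMultilinearMap.contDiff _).comp (contDiff_pi.2 fun _ => contDiff_id)
  have h2 := (contDiff_const (c := A)).clm_comp (h1.clm_comp (contDiff_const
    (c := ContinuousAlternatingMap.toContinuousMultilinearMapCLM ℝ
      (E := W) (F := ℝ) (ι := Fin k))))
  convert h2 using 1
  funext g
  ext1 f
  exact (hA (f.compContinuousLinearMap g)).symm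

variable (V) in
theorem contDiff_compLeft : ContDiff ℝ ∞ (fun c : ℝ →L[ℝ] ℝ =>
    (ContinuousLinearMap.compContinuousAlternatingMapCLM (ι := Fin k) ℝ V ℝ ℝ c :
      (V [⋀^Fin k]→L[ℝ] ℝ) →L[ℝ] (V [⋀^Fin k]→L[ℝ] ℝ))) := by
  let C : (ℝ →L[ℝ] ℝ) →L[ℝ] ((V [⋀^Fin k]→L[ℝ] ℝ) →L[ℝ] (V [⋀^Fin k]→L[ℝ] ℝ)) :=
    ContinuousLinearMap.compContinuousAlternatingMapCLM (ι := Fin k) ℝ V ℝ ℝ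
  exact ContinuousLinearMap.contDiff (𝕜 := ℝ) (E := ℝ →L[ℝ] ℝ)
    (F := (V [⋀^Fin k]→L[ℝ] ℝ) →L[ℝ] (V [⋀^Fin k]→L[ℝ] ℝ)) C
end

section Forms

variable (d : ℕ) {M : Type*} [TopologicalSpace M] [ChartedSpace (Model d) M]

/-- `Λᵏ T*ₓM`, for a manifold `M` of dimension `d`. -/
abbrev Form (k : ℕ) (x : M) : Type := TangentSpace (𝓡 d) x [⋀^Fin k]→L[ℝ] (Trivial M ℝ x)

variable [IsManifold (𝓡 d) ∞ M]

variable (M) in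
/-- The total space of the vector bundle `ΛᵏT*M → M`, with the topology and the charts that
Mathlib derives from those of the tangent bundle. -/
abbrev FormBundle (k : ℕ) : Type _ :=
  TotalSpace (Model d [⋀^Fin k]→L[ℝ] ℝ) (fun x : M => Form d k x)

/-- The model with corners of the manifold `ΛᵏT*M`. -/
abbrev formModel (k : ℕ) := (𝓡 d).prod 𝓘(ℝ, Model d [⋀^Fin k]→L[ℝ] ℝ)

variable (k : ℕ)

open Bundle.Pretrivialization in
instance formPrebundle_isContMDiff :
    (Bundle.ContinuousAlternatingMap.vectorPrebundle ℝ (Fin k) (Model d)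
    (fun x : M => TangentSpace (𝓡 d) x) ℝ (Trivial M ℝ)).IsContMDiff (𝓡 d) ∞ where
  exists_contMDiffCoordChange := by
    rintro _ ⟨e₁, e₂, he₁, he₂, rfl⟩ _ ⟨e₁', e₂', he₁', he₂', rfl⟩
    refine ⟨continuousAlternatingMapCoordChange ℝ (Fin k) e₁ e₁' e₂ e₂', ?_,
      continuousAlternatingMapCoordChange_apply⟩
    have hs₁ : e₁.baseSet ∩ e₂.baseSet ∩ (e₁'.baseSet ∩ e₂'.baseSet) ⊆
        e₁'.baseSet ∩ e₁.baseSet := by mfld_set_tac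
    have hs₂ : e₁.baseSet ∩ e₂.baseSet ∩ (e₁'.baseSet ∩ e₂'.baseSet) ⊆
        e₂.baseSet ∩ e₂'.baseSet := by mfld_set_tac
    have h₁ := (contMDiffOn_coordChangeL (IB := 𝓡 d) e₁' e₁ (n := ∞)).mono hs₁
    have h₂ := (contMDiffOn_coordChangeL (IB := 𝓡 d) e₂ e₂' (n := ∞)).mono hs₂
    exact ((contDiff_compLeft (Model d) k).contMDiff.comp_contMDiffOn h₂).clm_comp
      ((contDiff_compCLM k).contMDiff.comp_contMDiffOn h₁)

/-- `ΛᵏT*M → M` is a smooth vector bundle; in particular `ΛᵏT*M` is a smooth manifold. -/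
instance formBundle_contMDiffVectorBundle :
    ContMDiffVectorBundle ∞ (Model d [⋀^Fin k]→L[ℝ] ℝ)
    (fun x : M => TangentSpace (𝓡 d) x [⋀^Fin k]→L[ℝ] (Trivial M ℝ x)) (𝓡 d) :=
  (Bundle.ContinuousAlternatingMap.vectorPrebundle ℝ (Fin k) (Model d)
    (fun x : M => TangentSpace (𝓡 d) x) ℝ (Trivial M ℝ)).contMDiffVectorBundle (𝓡 d)

/-- The canonical `k`-form `Θ` on `ΛᵏT*M`:
`Θ_z(u₁, …, u_k) = z(Tpr u₁, …, Tpr u_k)`, where `pr : ΛᵏT*M → M` is the projection. -/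
def canonicalForm (z : FormBundle d M k) : TangentSpace (formModel d k) z [⋀^Fin k]→L[ℝ] ℝ :=
  z.2.compContinuousLinearMap
    (mfderiv (formModel d k) (𝓡 d) (TotalSpace.proj : FormBundle d M k → M) z)

end Forms

/-! ### Canonical lift of a vector field -/

section Lift

variable (d : ℕ) {M : Type*} [TopologicalSpace M] [ChartedSpace (Model d) M]
  [IsManifold (𝓡 d) ∞ M]

/-- `θ` is (near time `0` and the point `y₀`) the flow of the vector field `ζ`. -/
structure IsLocalFlow (ζ : ∀ y : M, TangentSpace (𝓡 d) y) (y₀ : M) (θ : ℝ → M → M) : Prop where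
  smooth : ContMDiffAt (𝓘(ℝ, ℝ).prod (𝓡 d)) (𝓡 d) ∞ (fun q : ℝ × M => θ q.1 q.2) (0, y₀)
  init : ∀ᶠ y in 𝓝 y₀, θ 0 y = y
  velocity : ∀ᶠ q : ℝ × M in 𝓝 (0, y₀), HasMFDerivAt 𝓘(ℝ, ℝ) (𝓡 d) (fun t => θ t q.2) q.1
    ((1 : ℝ →L[ℝ] ℝ).smulRight (ζ (θ q.1 q.2)))

/-- The canonical lift of the flow `θ` to `ΛᵏT*M`, i.e. push-forward of forms: the curve
`t ↦ (θₜ⁻¹)^* z` above `t ↦ θₜ(y)`, where `z ∈ ΛᵏT*_yM`. -/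
def liftedFlow {k : ℕ} (θ : ℝ → M → M) (z : FormBundle d M k) (t : ℝ) : FormBundle d M k :=
  ⟨θ t z.1, z.2.compContinuousLinearMap (mfderiv (𝓡 d) (𝓡 d) (θ t) z.1).inverse⟩

/-- On the subset `Z` of `ΛᵏT*M`, the vector field `ζZ` is the canonical lift of the vector field
`ζ` on `M`: it is the generator of the canonical lift of the flow of `ζ`. -/
def IsCanonicalLift {k : ℕ} (Z : Set (FormBundle d M k)) (ζ : ∀ y : M, TangentSpace (𝓡 d) y)
    (ζZ : ∀ z : FormBundle d M k, TangentSpace (formModel d k) z) : Prop :=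
  ∀ z ∈ Z, ∃ θ : ℝ → M → M, IsLocalFlow d ζ z.1 θ ∧ liftedFlow d θ z 0 = z ∧
    HasMFDerivAt 𝓘(ℝ, ℝ) (formModel d k) (liftedFlow d θ z) 0
      ((1 : ℝ →L[ℝ] ℝ).smulRight (ζZ (liftedFlow d θ z 0)))

end Lift

/-! ### Integration of top degree forms over compact oriented manifolds -/

section Integration

variable (d : ℕ) (M : Type*) [TopologicalSpace M] [ChartedSpace (Model d) M]
  [IsManifold (𝓡 d) ∞ M]

/-- An orientation of a `d`-dimensional manifold: an orientation of each tangent space, locally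
represented by a nowhere vanishing smooth `d`-form. -/
structure ManifoldOrientation where
  orient : ∀ x : M, Orientation ℝ (TangentSpace (𝓡 d) x) (Fin d)
  locally_smooth : ∀ x₀ : M, ∃ η : ∀ x : M, Form d d x,
    ContMDiffAt (𝓡 d) (formModel d d) ∞ (fun x => (⟨x, η x⟩ : FormBundle d M d)) x₀ ∧
    ∀ᶠ x in 𝓝 x₀, ∃ h : (η x).toAlternatingMap ≠ 0, orient x = rayOfNeZero ℝ _ h

variable {M}

/-- The frame `v` of `TₓM` is positively oriented. -/
def ManifoldOrientation.IsPositive (o : ManifoldOrientation d M) {x : M}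
    (v : Fin d → TangentSpace (𝓡 d) x) : Prop :=
  ∃ (η : TangentSpace (𝓡 d) x [⋀^Fin d]→ₗ[ℝ] ℝ) (h : η ≠ 0),
    o.orient x = rayOfNeZero ℝ η h ∧ 0 < η v

open Classical in
/-- `1` for positively oriented frames, `-1` for negatively oriented ones. -/
def ManifoldOrientation.sign (o : ManifoldOrientation d M) {x : M}
    (v : Fin d → TangentSpace (𝓡 d) x) : ℝ := if o.IsPositive d v then 1 else -1

/-- The frame of coordinate vector fields of the preferred chart at `i`, at the point with
coordinates `u`. -/
def coordFrame (i : M) (u : Model d) (j : Fin d) :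
    TangentSpace (𝓡 d) ((extChartAt (𝓡 d) i).symm u) :=
  mfderiv (𝓡 d) (𝓡 d) (extChartAt (𝓡 d) i).symm u (EuclideanSpace.single j (1 : ℝ))

variable (M) in
/-- A smooth partition of unity subordinate to the preferred charts. -/
def chartPartition [T2Space M] [SigmaCompactSpace M] : SmoothPartitionOfUnity M (𝓡 d) M univ :=
  (SmoothPartitionOfUnity.exists_isSubordinate_chartAt_source (𝓡 d) M).choose

/-- The integral of the `d`-form `η` over the compact oriented `d`-manifold `M`:
`∑ᵢ ∫ ρᵢ η`, each summand being computed in the chart at `i`. -/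
def integralForm [T2Space M] [CompactSpace M] (o : ManifoldOrientation d M)
    (η : ∀ x : M, Form d d x) : ℝ :=
  ∑ᶠ i : M, ∫ u in (extChartAt (𝓡 d) i).target,
    chartPartition d M i ((extChartAt (𝓡 d) i).symm u) *
      (o.sign d (coordFrame d i u) * η ((extChartAt (𝓡 d) i).symm u) (coordFrame d i u))

end Integration

/-! ### The configuration bundle and its first jet bundle

`X` is the `(n+1)`-dimensional spacetime, `pr : Y → X` the configuration bundle, with fibres of
dimension `N`; the reference Cauchy surface `S` has dimension `n`. -/

section Fields

variable {n N : ℕ}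
  {X : Type*} [TopologicalSpace X] [ChartedSpace (Model (n + 1)) X]
  {Y : Type*} [TopologicalSpace Y] [ChartedSpace (Model (n + 1 + N)) Y]
  {S : Type*} [TopologicalSpace S] [ChartedSpace (Model n) S]

variable (n N) in
/-- `pr : Y → X` is a smooth, locally trivial fibre bundle with typical fibre `F`. -/
structure IsSmoothFiberBundle (F : Type*) [TopologicalSpace F] [ChartedSpace (Model N) F]
    (pr : Y → X) : Prop where
  smooth : ContMDiff (𝓡 (n + 1 + N)) (𝓡 (n + 1)) ∞ pr
  locally_trivial : ∀ x : X, ∃ e : Trivialization F pr, x ∈ e.baseSet ∧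
    ContMDiffOn (𝓡 (n + 1 + N)) ((𝓡 (n + 1)).prod (𝓡 N)) ∞ e e.source ∧
    ContMDiffOn ((𝓡 (n + 1)).prod (𝓡 N)) (𝓡 (n + 1 + N)) ∞ e.toOpenPartialHomeomorph.symm
      e.target

variable (n N) in
/-- The vertical tangent space `V_yY`. -/
def VerticalSpace (pr : Y → X) (y : Y) : Submodule ℝ (TangentSpace (𝓡 (n + 1 + N)) y) :=
  LinearMap.ker (mfderiv (𝓡 (n + 1 + N)) (𝓡 (n + 1)) pr y).toLinearMap

variable (n N) in
/-- `γ : TₓX → T_yY` is an element of the first jet bundle `J¹Y`: `y` lies above `x` and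
`Tpr ∘ γ` is the identity of `TₓX`. -/
def IsJet (pr : Y → X) (x : X) (y : Y)
    (γ : TangentSpace (𝓡 (n + 1)) x →L[ℝ] TangentSpace (𝓡 (n + 1 + N)) y) : Prop :=
  ∃ h : pr y = x, ∀ w : TangentSpace (𝓡 (n + 1)) (pr y),
    mfderiv (𝓡 (n + 1 + N)) (𝓡 (n + 1)) pr y (γ (h ▸ w)) = w

variable (n N) in
/-- `ϕ` is a smooth section of `pr : Y → X`. -/
def IsSection (pr : Y → X) (ϕ : X → Y) : Prop :=
  ContMDiff (𝓡 (n + 1)) (𝓡 (n + 1 + N)) ∞ ϕ ∧ ∀ x, pr (ϕ x) = x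

variable [IsManifold (𝓡 (n + 1)) ∞ X] [IsManifold (𝓡 (n + 1 + N)) ∞ Y] [IsManifold (𝓡 n) ∞ S]

variable (n N) in
/-- The linear map `TₓX → T_yY` whose matrix is `A` in the coordinates given, on `TX` and on `TY`,
by the preferred charts at `x₀` and `y₀`. -/
def jetOfMatrix (x₀ : X) (y₀ : Y) (x : X) (y : Y) (A : Model (n + 1) →L[ℝ] Model (n + 1 + N)) :
    TangentSpace (𝓡 (n + 1)) x →L[ℝ] TangentSpace (𝓡 (n + 1 + N)) y :=
  ((trivializationAt (Model (n + 1 + N)) (TangentSpace (𝓡 (n + 1 + N))) y₀).symmL ℝ y).comp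
    (A.comp ((trivializationAt (Model (n + 1)) (TangentSpace (𝓡 (n + 1))) x₀).continuousLinearMapAt
      ℝ x))

variable (n N) in
/-- A Lagrangian density, i.e. a smooth bundle map `J¹Y → Λⁿ⁺¹X` over `X`; only the values of
`toFun` on jets are significant. Smoothness is expressed in local coordinates: the jet bundle is
locally the set of those `(x, y, A)` for which the map with matrix `A` is a jet. -/
structure LagrangianDensity (pr : Y → X) where
  toFun : ∀ (x : X) (y : Y), (TangentSpace (𝓡 (n + 1)) x →L[ℝ] TangentSpace (𝓡 (n + 1 + N)) y) →
    Form (n + 1) (n + 1) x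
  smooth : ∀ (x₀ : X) (y₀ : Y), ContMDiffOn
    (((𝓡 (n + 1)).prod (𝓡 (n + 1 + N))).prod 𝓘(ℝ, Model (n + 1) →L[ℝ] Model (n + 1 + N)))
    (formModel (n + 1) (n + 1)) ∞
    (fun q : (X × Y) × (Model (n + 1) →L[ℝ] Model (n + 1 + N)) =>
      (⟨q.1.1, toFun q.1.1 q.1.2 (jetOfMatrix n N x₀ y₀ q.1.1 q.1.2 q.2)⟩ :
        FormBundle (n + 1) X (n + 1)))
    {q | q.1.1 ∈ (chartAt (Model (n + 1)) x₀).source ∧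
      q.1.2 ∈ (chartAt (Model (n + 1 + N)) y₀).source ∧
      IsJet n N pr q.1.1 q.1.2 (jetOfMatrix n N x₀ y₀ q.1.1 q.1.2 q.2)}

/-! ### The multiphase space and the covariant Legendre transformation -/

variable (n N) in
/-- The multiphase space `Z ⊂ Λⁿ⁺¹Y`: the forms that vanish as soon as two of their arguments
are vertical. -/
def multiphaseSpace (pr : Y → X) : Set (FormBundle (n + 1 + N) Y (n + 1)) :=
  {z | ∀ (w : Fin (n + 1) → TangentSpace (𝓡 (n + 1 + N)) z.1) (i j : Fin (n + 1)), i ≠ j →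
    w i ∈ VerticalSpace n N pr z.1 → w j ∈ VerticalSpace n N pr z.1 → z.2 w = 0}

/-- `z ∈ Z_y` is the covariant Legendre transform `𝔽𝓛(γ)` of the jet `γ ∈ J¹_yY`. Here `Z_y` is
identified with the space of affine maps `J¹_yY → Λⁿ⁺¹ₓX` through `⟨z, γ'⟩ = γ'^* z`, and
`⟨𝔽𝓛(γ), γ'⟩ = 𝓛(γ) + d/dε|₀ 𝓛(γ + ε(γ' - γ))`. -/
def IsCovariantLegendre {pr : Y → X} (𝓛 : LagrangianDensity n N pr) (x : X) (y : Y)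
    (γ : TangentSpace (𝓡 (n + 1)) x →L[ℝ] TangentSpace (𝓡 (n + 1 + N)) y)
    (z : Form (n + 1 + N) (n + 1) y) : Prop :=
  (⟨y, z⟩ : FormBundle (n + 1 + N) Y (n + 1)) ∈ multiphaseSpace n N pr ∧
  ∀ γ' : TangentSpace (𝓡 (n + 1)) x →L[ℝ] TangentSpace (𝓡 (n + 1 + N)) y, IsJet n N pr x y γ' →
    ∀ w : Fin (n + 1) → TangentSpace (𝓡 (n + 1)) x,
      HasDerivAt (fun ε : ℝ => 𝓛.toFun x y (γ + ε • (γ' - γ)) w)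
        (z (fun i => γ' (w i)) - 𝓛.toFun x y γ w) 0

/-! ### Fields, velocities and momenta over a Cauchy surface

Objects over `Σ_τ = τ(S)` are parametrized by `S`, through the embedding `τ`. -/

/-- The space `𝒵_τ` of smooth sections of `Z` over `Σ_τ`. -/
def multimomentumFields (pr : Y → X) (τ : S → X) : Set (S → FormBundle (n + 1 + N) Y (n + 1)) :=
  {σ | ContMDiff (𝓡 n) (formModel (n + 1 + N) (n + 1)) ∞ σ ∧
    ∀ s, σ s ∈ multiphaseSpace n N pr ∧ pr (σ s).1 = τ s}

/-- The subset `𝒩_τ ⊂ 𝒵_τ`: the covariant Legendre transforms of the restrictions to `Σ_τ` of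
the jets of sections of `Y`. -/
def holonomicFields {pr : Y → X} (𝓛 : LagrangianDensity n N pr) (τ : S → X) :
    Set (S → FormBundle (n + 1 + N) Y (n + 1)) :=
  {σ | σ ∈ multimomentumFields pr τ ∧ ∃ ϕ : X → Y, IsSection n N pr ϕ ∧
    ∀ s, ∃ z : Form (n + 1 + N) (n + 1) (ϕ (τ s)),
      IsCovariantLegendre 𝓛 (τ s) (ϕ (τ s)) (mfderiv (𝓡 (n + 1)) (𝓡 (n + 1 + N)) ϕ (τ s)) z ∧
      σ s = ⟨ϕ (τ s), z⟩}

variable (n N) in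
/-- The `τ`-configuration space `𝒴_τ`: smooth sections of `Y` over `Σ_τ`. -/
def configurations (pr : Y → X) (τ : S → X) : Set (S → Y) :=
  {φ | ContMDiff (𝓡 n) (𝓡 (n + 1 + N)) ∞ φ ∧ ∀ s, pr (φ s) = τ s}

variable (n N) in
/-- The tangent space `T_φ𝒴_τ`: smooth vertical vector fields along `φ`. -/
def velocities (pr : Y → X) (φ : S → Y) : Set (∀ s, VerticalSpace n N pr (φ s)) :=
  {V | ContMDiff (𝓡 n) (𝓡 (n + 1 + N)).tangent ∞
    (fun s => (⟨φ s, (V s).1⟩ : TangentBundle (𝓡 (n + 1 + N)) Y))}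

variable (n N S) in
/-- A pair `(φ, π)` of a map `φ : Σ_τ → Y` and a map `π : Σ_τ → L(VY_τ, ΛⁿΣ_τ)` covering `φ`. -/
structure PhasePoint (pr : Y → X) where
  config : S → Y
  momentum : ∀ s, VerticalSpace n N pr (config s) →ₗ[ℝ] Form n n s

/-- The `τ`-phase space `T^*𝒴_τ` (smooth cotangent bundle). A momentum is smooth when it
transforms smooth vertical vector fields along `φ` into smooth `n`-forms. -/
def phaseSpace (pr : Y → X) (τ : S → X) : Set (PhasePoint n N S pr) :=
  {p | p.config ∈ configurations n N pr τ ∧ ∀ V ∈ velocities n N pr p.config,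
    ContMDiff (𝓡 n) (formModel n n) ∞ (fun s => (⟨s, p.momentum s (V s)⟩ : FormBundle n S n))}

/-- The reduction map `R_τ : 𝒵_τ → T^*𝒴_τ`, `⟨R_τ(σ)(s), v⟩ = φ^*(i_v σ(s))`, where `φ` is the
projection of `σ` to `Y`. -/
def reduction (pr : Y → X) (σ : S → FormBundle (n + 1 + N) Y (n + 1)) : PhasePoint n N S pr where
  config s := (σ s).1
  momentum s :=
    { toFun v := (interior v.1 (σ s).2).compContinuousLinearMap
        (mfderiv (𝓡 n) (𝓡 (n + 1 + N)) (fun s => (σ s).1) s)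
      map_add' u v := by
        ext w
        exact DFunLike.congr_fun ((σ s).2.toAlternatingMap.curryLeft.map_add u.1 v.1) _
      map_smul' c v := by
        ext w
        exact DFunLike.congr_fun ((σ s).2.toAlternatingMap.curryLeft.map_smul c v.1) _ }

/-- `σ` is a holonomic lift of `(φ, π)`: an element of `R_τ⁻¹{(φ, π)} ∩ 𝒩_τ`. -/
def IsHolonomicLift {pr : Y → X} (𝓛 : LagrangianDensity n N pr) (τ : S → X)
    (σ : S → FormBundle (n + 1 + N) Y (n + 1)) (p : PhasePoint n N S pr) : Prop :=
  σ ∈ holonomicFields 𝓛 τ ∧ reduction pr σ = p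

/-! ### Slicings and the instantaneous formalism -/

variable (n N) in
/-- A smooth vector field `ζ = ζ_Y` on `Y` that projects to a smooth vector field `ζ_X` on `X`. -/
structure ProjectableField (pr : Y → X) where
  field : ∀ y : Y, TangentSpace (𝓡 (n + 1 + N)) y
  base : ∀ x : X, TangentSpace (𝓡 (n + 1)) x
  smooth : ContMDiff (𝓡 (n + 1 + N)) (𝓡 (n + 1 + N)).tangent ∞
    (fun y => (⟨y, field y⟩ : TangentBundle (𝓡 (n + 1 + N)) Y))
  smooth_base : ContMDiff (𝓡 (n + 1)) (𝓡 (n + 1)).tangent ∞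
    (fun x => (⟨x, base x⟩ : TangentBundle (𝓡 (n + 1)) X))
  project : ∀ y, mfderiv (𝓡 (n + 1 + N)) (𝓡 (n + 1)) pr y (field y) = base (pr y)

/-- `ζ_X` is everywhere transverse to `Σ_τ`, so that `(Σ_τ, ζ_X)` and `(Y_τ, ζ_Y)` are compatible
infinitesimal slicings. -/
def ProjectableField.IsTransverse {pr : Y → X} (ζ : ProjectableField n N pr) (τ : S → X) : Prop :=
  ∀ s, ζ.base (τ s) ∉ Set.range (mfderiv (𝓡 n) (𝓡 (n + 1)) τ s)

/-- The jet decomposition map `β_ζ : (J¹Y)_τ → J¹(Y_τ) × VY_τ`. It sends the jet of `ϕ` at `τ(s)`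
to the pair of the jet of `φ = ϕ ∘ τ` at `s` and the value
`φ̇ = (Tϕ ∘ ζ_X - ζ_Y ∘ ϕ)(τ(s))` of the Lie derivative of `ϕ` along `ζ`. -/
def jetDecomposition {pr : Y → X} (ζ : ProjectableField n N pr) (τ : S → X) (s : S) (y : Y)
    (γ : TangentSpace (𝓡 (n + 1)) (τ s) →L[ℝ] TangentSpace (𝓡 (n + 1 + N)) y) :
    (TangentSpace (𝓡 n) s →L[ℝ] TangentSpace (𝓡 (n + 1 + N)) y) ×
      TangentSpace (𝓡 (n + 1 + N)) y :=
  (γ.comp (mfderiv (𝓡 n) (𝓡 (n + 1)) τ s), γ (ζ.base (τ s)) - ζ.field y)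

/-- The jet reconstruction map `β_ζ⁻¹`. -/
def jetReconstruction {pr : Y → X} (ζ : ProjectableField n N pr) (τ : S → X) (s : S) (y : Y)
    (κ : TangentSpace (𝓡 n) s →L[ℝ] TangentSpace (𝓡 (n + 1 + N)) y)
    (v : TangentSpace (𝓡 (n + 1 + N)) y) :
    TangentSpace (𝓡 (n + 1)) (τ s) →L[ℝ] TangentSpace (𝓡 (n + 1 + N)) y :=
  Classical.epsilon fun γ => IsJet n N pr (τ s) y γ ∧ jetDecomposition ζ τ s y γ = (κ, v)

/-- The space + time split Lagrangian density `𝓛_{τ,ζ} : J¹(Y_τ) × VY_τ → ΛⁿΣ_τ`,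
`𝓛_{τ,ζ}(κ, v) = i_τ^* i_{ζ_X} 𝓛(β_ζ⁻¹(κ, v))`. -/
def splitDensity {pr : Y → X} (𝓛 : LagrangianDensity n N pr) (ζ : ProjectableField n N pr)
    (τ : S → X) (s : S) (y : Y) (κ : TangentSpace (𝓡 n) s →L[ℝ] TangentSpace (𝓡 (n + 1 + N)) y)
    (v : TangentSpace (𝓡 (n + 1 + N)) y) : Form n n s :=
  (interior (ζ.base (τ s)) (𝓛.toFun (τ s) y (jetReconstruction ζ τ s y κ v))).compContinuousLinearMap
    (mfderiv (𝓡 n) (𝓡 (n + 1)) τ s)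

/-- The `n`-form `𝓛_{τ,ζ}(j¹φ, φ̇)` on `Σ_τ`. -/
def lagrangianForm {pr : Y → X} (𝓛 : LagrangianDensity n N pr) (ζ : ProjectableField n N pr)
    (τ : S → X) (φ : S → Y) (V : ∀ s, VerticalSpace n N pr (φ s)) (s : S) : Form n n s :=
  splitDensity 𝓛 ζ τ s (φ s) (mfderiv (𝓡 n) (𝓡 (n + 1 + N)) φ s) (V s).1

/-- The instantaneous Legendre transform: `p = (φ, π) = 𝔽L_{τ,ζ}(φ, φ̇)`, i.e. `π = ∂𝓛_{τ,ζ}/∂φ̇` is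
the fibre derivative of `𝓛_{τ,ζ}` along `VY_τ` at `(j¹φ, φ̇)`. -/
def IsInstLegendre {pr : Y → X} (𝓛 : LagrangianDensity n N pr) (ζ : ProjectableField n N pr)
    (τ : S → X) (p : PhasePoint n N S pr) (V : ∀ s, VerticalSpace n N pr (p.config s)) : Prop :=
  ∀ (s : S) (v : VerticalSpace n N pr (p.config s)) (w : Fin n → TangentSpace (𝓡 n) s),
    HasDerivAt (fun ε : ℝ => splitDensity 𝓛 ζ τ s (p.config s)
      (mfderiv (𝓡 n) (𝓡 (n + 1 + N)) p.config s) ((V s).1 + ε • v.1) w)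
      (p.momentum s v w) 0

/-- The fibre `𝔽L_{τ,ζ}⁻¹(p) ⊂ T𝒴_τ`, as a set of velocities over the configuration of `p`. -/
def legendreFiber {pr : Y → X} (𝓛 : LagrangianDensity n N pr) (ζ : ProjectableField n N pr)
    (τ : S → X) (p : PhasePoint n N S pr) : Set (∀ s, VerticalSpace n N pr (p.config s)) :=
  {V | V ∈ velocities n N pr p.config ∧ IsInstLegendre 𝓛 ζ τ p V}

/-- The instantaneous primary constraint set `𝒫_{τ,ζ} = im 𝔽L_{τ,ζ} ⊂ T^*𝒴_τ`. -/
def primaryConstraintSet {pr : Y → X} (𝓛 : LagrangianDensity n N pr) (ζ : ProjectableField n N pr)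
    (τ : S → X) : Set (PhasePoint n N S pr) :=
  {p | p ∈ phaseSpace pr τ ∧ (legendreFiber 𝓛 ζ τ p).Nonempty}

/-- The fibres of the instantaneous Legendre transform are connected, in the sense that any two
points of a fibre are joined by a smooth curve in it. (For the fibres of a submersion, which are
submanifolds, this is the same as connectedness.) -/
def HasConnectedLegendreFibers {pr : Y → X} (𝓛 : LagrangianDensity n N pr)
    (ζ : ProjectableField n N pr) (τ : S → X) : Prop :=
  ∀ p ∈ primaryConstraintSet 𝓛 ζ τ,
    ∀ V₀ ∈ legendreFiber 𝓛 ζ τ p, ∀ V₁ ∈ legendreFiber 𝓛 ζ τ p,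
      ∃ c : ℝ → ∀ s, VerticalSpace n N pr (p.config s),
        ContMDiff (𝓘(ℝ, ℝ).prod (𝓡 n)) (𝓡 (n + 1 + N)).tangent ∞
          (fun q : ℝ × S => (⟨p.config q.2, (c q.1 q.2).1⟩ : TangentBundle (𝓡 (n + 1 + N)) Y)) ∧
        c 0 = V₀ ∧ c 1 = V₁ ∧ ∀ t ∈ Set.Icc (0 : ℝ) 1, c t ∈ legendreFiber 𝓛 ζ τ p

/-- The density `π(φ̇) - 𝓛_{τ,ζ}(j¹φ, φ̇)` of the energy. -/
def energyDensity {pr : Y → X} (𝓛 : LagrangianDensity n N pr) (ζ : ProjectableField n N pr)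
    (τ : S → X) (p : PhasePoint n N S pr) (V : ∀ s, VerticalSpace n N pr (p.config s)) (s : S) :
    Form n n s :=
  p.momentum s (V s) - lagrangianForm 𝓛 ζ τ p.config V s

section Hamiltonian

variable [T2Space S] [CompactSpace S]

/-- The instantaneous Lagrangian `L_{τ,ζ}(φ, φ̇) = ∫_{Σ_τ} 𝓛_{τ,ζ}(j¹φ, φ̇)`. -/
def instLagrangian (o : ManifoldOrientation n S) {pr : Y → X} (𝓛 : LagrangianDensity n N pr)
    (ζ : ProjectableField n N pr) (τ : S → X) (φ : S → Y)
    (V : ∀ s, VerticalSpace n N pr (φ s)) : ℝ :=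
  integralForm n o (lagrangianForm 𝓛 ζ τ φ V)

/-- The pairing `⟨π, φ̇⟩ = ∫_{Σ_τ} π(φ̇)` of `T^*_φ𝒴_τ` with `T_φ𝒴_τ`. -/
def pairing (o : ManifoldOrientation n S) {pr : Y → X} (p : PhasePoint n N S pr)
    (V : ∀ s, VerticalSpace n N pr (p.config s)) : ℝ :=
  integralForm n o (fun s => p.momentum s (V s))

/-- The energy `⟨π, φ̇⟩ - L_{τ,ζ}(φ, φ̇)`. -/
def energy (o : ManifoldOrientation n S) {pr : Y → X} (𝓛 : LagrangianDensity n N pr)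
    (ζ : ProjectableField n N pr) (τ : S → X) (p : PhasePoint n N S pr)
    (V : ∀ s, VerticalSpace n N pr (p.config s)) : ℝ :=
  pairing o p V - instLagrangian o 𝓛 ζ τ p.config V

/-- The instantaneous Hamiltonian `H_{τ,ζ}(φ, π) = ⟨π, φ̇⟩ - L_{τ,ζ}(φ, φ̇)`, where `φ̇` is any
velocity with `𝔽L_{τ,ζ}(φ, φ̇) = (φ, π)`. It is meaningful on the primary constraint set only. -/
def hamiltonian (o : ManifoldOrientation n S) {pr : Y → X} (𝓛 : LagrangianDensity n N pr)
    (ζ : ProjectableField n N pr) (τ : S → X) (p : PhasePoint n N S pr) : ℝ :=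
  energy o 𝓛 ζ τ p (Classical.epsilon fun V => V ∈ legendreFiber 𝓛 ζ τ p)

end Hamiltonian

/-- The density of the instantaneous Hamiltonian. -/
def hamiltonianDensity {pr : Y → X} (𝓛 : LagrangianDensity n N pr) (ζ : ProjectableField n N pr)
    (τ : S → X) (p : PhasePoint n N S pr) (s : S) : Form n n s :=
  energyDensity 𝓛 ζ τ p (Classical.epsilon fun V => V ∈ legendreFiber 𝓛 ζ τ p) s

/-- The `n`-form `σ^*(i_{ζ_Z} Θ)` on `Σ_τ`. -/
def pulledBackForm (ζZ : ∀ z : FormBundle (n + 1 + N) Y (n + 1),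
      TangentSpace (formModel (n + 1 + N) (n + 1)) z)
    (σ : S → FormBundle (n + 1 + N) Y (n + 1)) (s : S) : Form n n s :=
  (interior (ζZ (σ s)) (canonicalForm (n + 1 + N) (n + 1) (σ s))).compContinuousLinearMap
    (mfderiv (𝓡 n) (formModel (n + 1 + N) (n + 1)) σ s)

end Fields

end FieldTheory

end

noncomputable section

namespace FieldTheory

/-! A holonomic lift `σ = 𝔽𝓛 ∘ j¹ϕ ∘ τ` singles out one velocity, the Lie derivative `φ̇ = Tϕ ∘ ζ_X
- ζ_Y ∘ ϕ`. Let `α` be the covector with kernel `TΣ_τ` and `α(ζ_X) = 1`. Testing the definition of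
`z = 𝔽𝓛(γ)` on the jets `γ + α ⊗ v` with `v` vertical, and evaluating on `ζ_X` followed by vectors
tangent to `Σ_τ`, shows that the derivative of `𝓛_{τ,ζ}` at `φ̇` along `v` is `φ^*(i_v z)`. So `φ̇`
lies in the Legendre fibre of `R_τ(σ)` (`IsCovariantLegendre.lieDerivative_mem_legendreFiber`).
Testing on `γ` itself gives `γ^* z = 𝓛(γ)`, hence `π(φ̇) - 𝓛_{τ,ζ} = φ^*(i_{φ̇} z) - φ^*(i_{Tϕ ζ_X}
z) = -φ^*(i_{ζ_Y} z)` (`IsCovariantLegendre.energy_eq`). As `ζ_Z` projects to `ζ_Y`, this is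
`-σ^*(i_{ζ_Z} Θ)` (`pulledBackForm_apply`).

Any other velocity in the fibre is joined to `φ̇` by a curve `c` inside the fibre. At each point of
`Σ_τ` the energy along `c` has derivative `π(ċ) - D𝓛_{τ,ζ}(ċ) = 0` (`legendre_energy_constant`), so
its density does not depend on the velocity.

The Hamiltonian is a difference of two integrals. Passing from densities to numbers therefore needs
additivity of `integralForm`, hence integrability of the local expressions (`integralForm_add`). -/

/-! ### Continuity of evaluations, and additivity of the integral -/

section Evaluation

variable {d k : ℕ} {M : Type*} [TopologicalSpace M] [ChartedSpace (Model d) M]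
  [IsManifold (𝓡 d) ∞ M]

/-- A form is evaluated by evaluating its coordinate representation on the coordinates of the
vectors. -/
theorem eval_eq_coordinates {x₀ x : M} (hx : x ∈ (chartAt (Model d) x₀).source)
    (η : Form d k x) (v : Fin k → TangentSpace (𝓡 d) x) :
    η v = (trivializationAt (Model d [⋀^Fin k]→L[ℝ] ℝ) (fun x : M => Form d k x) x₀ ⟨x, η⟩).2
      (fun j => (trivializationAt (Model d) (TangentSpace (𝓡 d)) x₀ ⟨x, v j⟩).2) := by
  rw [FiberBundle.trivializationAt_continuousAlternatingMap_apply]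
  change η v = (Trivialization.continuousLinearMapAt ℝ
    (trivializationAt ℝ (Trivial M ℝ) x₀) x) (η fun j =>
      (trivializationAt (Model d) (TangentSpace (𝓡 d)) x₀).symmL ℝ x
        (trivializationAt (Model d) (TangentSpace (𝓡 d)) x₀ ⟨x, v j⟩).2)
  have h : ∀ j, (trivializationAt (Model d) (TangentSpace (𝓡 d)) x₀).symmL ℝ x
      (trivializationAt (Model d) (TangentSpace (𝓡 d)) x₀ ⟨x, v j⟩).2 = v j := fun j => by
    have := (trivializationAt (Model d) (TangentSpace (𝓡 d)) x₀).symmL_continuousLinearMapAt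
      (R := ℝ) (b := x) (by simpa using hx) (v j)
    rwa [Trivialization.continuousLinearMapAt_apply, Trivialization.linearMapAt_apply,
      if_pos (by simpa using hx)] at this
  simp only [h]
  simp

theorem continuousAt_eval {U : Type*} [TopologicalSpace U] {u₀ : U} {f : U → M}
    {η : ∀ u, Form d k (f u)} {v : ∀ u, Fin k → TangentSpace (𝓡 d) (f u)}
    (hη : ContinuousAt (fun u => (⟨f u, η u⟩ : FormBundle d M k)) u₀)
    (hv : ∀ j, ContinuousAt (fun u => (⟨f u, v u j⟩ : TangentBundle (𝓡 d) M)) u₀) :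
    ContinuousAt (fun u => η u (v u)) u₀ := by
  obtain ⟨hf, hη⟩ := (FiberBundle.continuousAt_totalSpace _ _).1 hη
  have hv' := fun j => ((FiberBundle.continuousAt_totalSpace _ _).1 (hv j)).2
  have h1 : ∀ᶠ u in 𝓝 u₀, f u ∈ (chartAt (Model d) (f u₀)).source :=
    hf.eventually ((chartAt (Model d) (f u₀)).open_source.mem_nhds (mem_chart_source _ _))
  refine ContinuousAt.congr ?_ (h1.mono fun u hu => (eval_eq_coordinates hu (η u) (v u)).symm)
  exact (continuous_eval (F := Model d [⋀^Fin k]→L[ℝ] ℝ)).continuousAt.comp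
    (hη.prodMk (continuousAt_pi.2 hv'))

/-- The coordinate vector fields of a chart are continuous. -/
theorem continuousAt_coordFrame (i : M) {u : Model d} (hu : u ∈ (extChartAt (𝓡 d) i).target)
    (j : Fin d) : ContinuousAt (fun u => (⟨(extChartAt (𝓡 d) i).symm u, coordFrame d i u j⟩ :
      TangentBundle (𝓡 d) M)) u := by
  have ho : IsOpen (extChartAt (𝓡 d) i).target := isOpen_extChartAt_target i
  have hs : ContMDiffOn 𝓘(ℝ, Model d) (𝓡 d) ∞ (extChartAt (𝓡 d) i).symm
    (extChartAt (𝓡 d) i).target := contMDiffOn_extChartAt_symm i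
  have h := hs.continuousOn_tangentMapWithin (by simp) ho.uniqueMDiffOn
  have hc : Continuous (fun u : Model d =>
      (⟨u, EuclideanSpace.single j (1 : ℝ)⟩ : TangentBundle 𝓘(ℝ, Model d) (Model d))) :=
    (tangentBundleModelSpaceHomeomorph 𝓘(ℝ, Model d)).symm.continuous.comp
      (continuous_id.prodMk continuous_const)
  have h2 := h.comp hc.continuousOn (s := (extChartAt (𝓡 d) i).target) (fun v hv => hv)
  refine (h2.continuousAt (ho.mem_nhds hu)).congr ?_
  filter_upwards [ho.mem_nhds hu] with v hv
  exact tangentMapWithin_eq_tangentMap (ho.uniqueMDiffOn v hv)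
    ((hs.contMDiffAt (ho.mem_nhds hv)).mdifferentiableAt (by simp))

end Evaluation

section Integration

variable {d : ℕ} {M : Type*} [TopologicalSpace M] [ChartedSpace (Model d) M]
  [IsManifold (𝓡 d) ∞ M]

/-- Nonzero forms on the same ray are positive multiples of each other, so any representative
decides positivity. This allows testing with the smooth local representative. -/
theorem ManifoldOrientation.isPositive_iff (o : ManifoldOrientation d M) {x : M}
    {η : Form d d x} (h : η.toAlternatingMap ≠ 0) (ho : o.orient x = rayOfNeZero ℝ _ h)
    (v : Fin d → TangentSpace (𝓡 d) x) : o.IsPositive d v ↔ 0 < η v := by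
  refine ⟨?_, fun hv => ⟨_, h, ho, hv⟩⟩
  rintro ⟨η', h', ho', hv⟩
  obtain ⟨r₁, r₂, hr₁, hr₂, hr⟩ := ((ray_eq_iff h h').1 (ho.symm.trans ho')).exists_pos h h'
  have := DFunLike.congr_fun hr v
  have h3 : r₁ * η v = r₂ * η' v := this
  exact pos_of_mul_pos_right (h3 ▸ mul_pos hr₂ hv) hr₁.le

/-- Near a given point, positivity says that a function continuous there, the smooth representative
evaluated on the coordinate frame, is positive. Openness yields the measurability of the sign in the
integrand. -/
theorem isOpen_isPositive_coordFrame (o : ManifoldOrientation d M) (i : M) :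
    IsOpen {u | u ∈ (extChartAt (𝓡 d) i).target ∧ o.IsPositive d (coordFrame d i u)} := by
  rw [isOpen_iff_mem_nhds]
  rintro u ⟨hu, hp⟩
  obtain ⟨η, hη, ho⟩ := o.locally_smooth ((extChartAt (𝓡 d) i).symm u)
  have hc : ContinuousAt (extChartAt (𝓡 d) i).symm u := continuousAt_extChartAt_symm'' hu
  obtain ⟨h, h'⟩ := ho.self_of_nhds
  have hpos := (o.isPositive_iff h h' _).1 hp
  have hev : ContinuousAt (fun u => η ((extChartAt (𝓡 d) i).symm u) (coordFrame d i u)) u :=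
    continuousAt_eval (hη.continuousAt.comp (f := (extChartAt (𝓡 d) i).symm) hc)
      (fun j => continuousAt_coordFrame i hu j)
  filter_upwards [hc.eventually ho, hev.eventually (lt_mem_nhds hpos),
    (isOpen_extChartAt_target (I := 𝓡 d) i).mem_nhds hu] with w hw hw' hw''
  obtain ⟨h, h'⟩ := hw
  exact ⟨hw'', (o.isPositive_iff h h' _).2 hw'⟩

variable [T2Space M] [CompactSpace M]

/-- The local expression of `ρᵢ η` is integrable when `η` is continuous. -/
theorem integrableOn_localExpression (o : ManifoldOrientation d M) (i : M)
    {η : ∀ x : M, Form d d x}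
    (hη : ContinuousOn (fun u => η ((extChartAt (𝓡 d) i).symm u) (coordFrame d i u))
      (extChartAt (𝓡 d) i).target) :
    MeasureTheory.IntegrableOn (fun u => chartPartition d M i ((extChartAt (𝓡 d) i).symm u) *
      (o.sign d (coordFrame d i u) * η ((extChartAt (𝓡 d) i).symm u) (coordFrame d i u)))
      (extChartAt (𝓡 d) i).target := by
  set T := (extChartAt (𝓡 d) i).target with hT
  -- The integrand vanishes off `K`, the image in the chart of the support of `ρᵢ`. `K` is compact
  -- and lies in the chart's target, so integrability over `K` suffices.
  have hTo : IsOpen T := isOpen_extChartAt_target i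
  have hsub : tsupport (chartPartition d M i) ⊆ (extChartAt (𝓡 d) i).source := by
    rw [extChartAt_source]
    exact (SmoothPartitionOfUnity.exists_isSubordinate_chartAt_source (𝓡 d) M).choose_spec i
  set K := extChartAt (𝓡 d) i '' tsupport (chartPartition d M i) with hK
  have hKc : IsCompact K :=
    (isClosed_tsupport _).isCompact.image_of_continuousOn ((continuousOn_extChartAt i).mono hsub)
  have hKT : K ⊆ T := by
    rintro _ ⟨x, hx, rfl⟩
    exact (extChartAt (𝓡 d) i).map_source (hsub hx)
  have hsymm : ContinuousOn (extChartAt (𝓡 d) i).symm T := continuousOn_extChartAt_symm i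
  refine MeasureTheory.IntegrableOn.of_forall_sdiff_eq_zero (s := K) ?_ hTo.measurableSet ?_
  · have hcont : ContinuousOn (fun u => chartPartition d M i ((extChartAt (𝓡 d) i).symm u) *
        η ((extChartAt (𝓡 d) i).symm u) (coordFrame d i u)) T :=
      ((chartPartition d M i).contMDiff.continuous.comp_continuousOn hsymm).mul hη
    have hint := (hcont.mono hKT).integrableOn_compact hKc (μ := MeasureTheory.volume)
    have hmeas : MeasureTheory.AEStronglyMeasurable (fun u => o.sign d (coordFrame d i u))
        (MeasureTheory.volume.restrict K) := by
      classical
      have h1 := (isOpen_isPositive_coordFrame o i).measurableSet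
      refine MeasureTheory.AEStronglyMeasurable.congr (f := fun u =>
        if u ∈ {u | u ∈ T ∧ o.IsPositive d (coordFrame d i u)} then (1 : ℝ) else -1)
        (Measurable.ite h1 measurable_const measurable_const).aestronglyMeasurable ?_
      refine (MeasureTheory.ae_restrict_iff' hKc.measurableSet).2 (.of_forall fun u hu => ?_)
      simp only [ManifoldOrientation.sign, mem_ofPred_eq, hKT hu, true_and]
    -- A measurable factor with values `±1` times a function continuous on the compact set `K`.
    refine (hint.bdd_mul (c := 1) hmeas (.of_forall fun u => ?_)).congr (.of_forall fun u => ?_)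
    · unfold ManifoldOrientation.sign
      split_ifs <;> simp
    · simp only
      ring
  · rintro u ⟨hu, huK⟩
    have h : (extChartAt (𝓡 d) i).symm u ∉ tsupport (chartPartition d M i) := fun h =>
      huK ⟨_, h, (extChartAt (𝓡 d) i).right_inv hu⟩
    simp only [image_eq_zero_of_notMem_tsupport h, zero_mul]

/-- On a compact manifold only finitely many functions of a locally finite partition are nonzero.
Without finite support, `finsum` would take its default value `0` and fail to be additive. -/
theorem finite_support_integral (o : ManifoldOrientation d M) (η : ∀ x : M, Form d d x) :
    (Function.support fun i : M => ∫ u in (extChartAt (𝓡 d) i).target,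
      chartPartition d M i ((extChartAt (𝓡 d) i).symm u) *
        (o.sign d (coordFrame d i u) *
          η ((extChartAt (𝓡 d) i).symm u) (coordFrame d i u))).Finite := by
  refine (chartPartition d M).locallyFinite.finite_nonempty_of_compact.subset fun i hi => ?_
  by_contra h
  rw [mem_ofPred_eq, not_nonempty_iff_eq_empty, Function.support_eq_empty_iff] at h
  apply hi
  simp only [h, Pi.zero_apply, zero_mul, MeasureTheory.integral_zero]

theorem integralForm_add (o : ManifoldOrientation d M) {η₁ η₂ : ∀ x : M, Form d d x}
    (h₁ : ∀ i, ContinuousOn (fun u => η₁ ((extChartAt (𝓡 d) i).symm u) (coordFrame d i u))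
      (extChartAt (𝓡 d) i).target)
    (h₂ : ∀ i, ContinuousOn (fun u => η₂ ((extChartAt (𝓡 d) i).symm u) (coordFrame d i u))
      (extChartAt (𝓡 d) i).target) :
    integralForm d o (fun x => η₁ x + η₂ x) = integralForm d o η₁ + integralForm d o η₂ := by
  unfold integralForm
  rw [← finsum_add_distrib (finite_support_integral o η₁) (finite_support_integral o η₂)]
  refine finsum_congr fun i => ?_
  rw [← MeasureTheory.integral_add (integrableOn_localExpression o i (h₁ i))
    (integrableOn_localExpression o i (h₂ i))]
  refine MeasureTheory.integral_congr_ae (.of_forall fun u => ?_)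
  simp only [ContinuousAlternatingMap.add_apply]
  ring

end Integration

/-! ### Immersions and transverse vectors -/

/-- In suitable charts an immersion is `u ↦ (u, 0)`. Projecting onto the first factor gives a smooth
local left inverse `g`, and the chain rule for `g ∘ f = id` gives a left inverse of the derivative.
-/
theorem mfderiv_injective_of_isImmersionAt {m k : ℕ} {S : Type*} [TopologicalSpace S]
    [ChartedSpace (Model m) S] [IsManifold (𝓡 m) ∞ S] {X : Type*} [TopologicalSpace X]
    [ChartedSpace (Model k) X] [IsManifold (𝓡 k) ∞ X] {f : S → X} {s : S}
    (h : Manifold.IsImmersionAt (𝓡 m) (𝓡 k) ∞ f s) :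
    Function.Injective (mfderiv (𝓡 m) (𝓡 k) f s) := by
  let r : Model k → Model m := fun u => (h.equiv.symm u).1
  let g : X → S := (h.domChart.extend (𝓡 m)).symm ∘ r ∘ h.codChart.extend (𝓡 k)
  have hsrc : ∀ s' ∈ h.domChart.source, r (h.codChart.extend (𝓡 k) (f s')) =
      h.domChart.extend (𝓡 m) s' := fun s' hs' => by
    have hs'' : s' ∈ (h.domChart.extend (𝓡 m)).source := by
      rwa [OpenPartialHomeomorph.extend_source]
    have := h.writtenInCharts ((h.domChart.extend (𝓡 m)).map_source hs'')
    simp only [Function.comp_apply, (h.domChart.extend (𝓡 m)).left_inv hs''] at this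
    simp only [r, this, ContinuousLinearEquiv.symm_apply_apply]
  have hg : ContMDiffAt (𝓡 k) (𝓡 m) ∞ g (f s) := by
    have h1 : ContMDiffAt (𝓡 k) 𝓘(ℝ, Model k) ∞ (h.codChart.extend (𝓡 k)) (f s) :=
      h.codChart.contMDiffAt_extend h.codChart_mem_maximalAtlas h.mem_codChart_source
    have h2 : ContMDiff 𝓘(ℝ, Model k) 𝓘(ℝ, Model m) ∞ r :=
      (contDiff_fst.comp h.equiv.symm.contDiff).contMDiff
    have h3 : ContMDiffAt 𝓘(ℝ, Model m) (𝓡 m) ∞ (h.domChart.extend (𝓡 m)).symm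
        (h.domChart.extend (𝓡 m) s) := by
      refine (contMDiffOn_extend_symm h.domChart_mem_maximalAtlas).contMDiffAt
        (IsOpen.mem_nhds ?_ ?_)
      · simpa using h.domChart.open_target
      · exact ⟨_, h.domChart.map_source h.mem_domChart_source, rfl⟩
    refine ContMDiffAt.comp (f s) ?_ (h2.contMDiffAt.comp (f s) h1)
    rw [Function.comp_apply, hsrc s h.mem_domChart_source]
    exact h3
  have hgf : g ∘ f =ᶠ[𝓝 s] id := by
    filter_upwards [h.domChart.open_source.mem_nhds h.mem_domChart_source] with s' hs'
    simp only [g, Function.comp_apply, hsrc s' hs', id]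
    exact (h.domChart.extend (𝓡 m)).left_inv (by rwa [OpenPartialHomeomorph.extend_source])
  have hcomp : mfderiv (𝓡 m) (𝓡 m) (g ∘ f) s = (mfderiv (𝓡 k) (𝓡 m) g (f s)).comp
      (mfderiv (𝓡 m) (𝓡 k) f s) :=
    mfderiv_comp s (hg.mdifferentiableAt (by simp)) (h.contMDiffAt.mdifferentiableAt (by simp))
  rw [hgf.mfderiv_eq, mfderiv_id] at hcomp
  intro v w hvw
  have hv := DFunLike.congr_fun hcomp v
  have hw := DFunLike.congr_fun hcomp w
  exact hv.trans ((congrArg (mfderiv (𝓡 k) (𝓡 m) g (f s)) hvw).trans hw.symm)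

/-- The covector dual to a vector transverse to a hyperplane. -/
theorem exists_transverse_covector {n : ℕ} (T : Model n →L[ℝ] Model (n + 1))
    (hT : Function.Injective T) {b : Model (n + 1)} (hb : b ∉ Set.range T) :
    ∃ α : Model (n + 1) →L[ℝ] ℝ, α b = 1 ∧ (∀ a, α (T a) = 0) ∧
      ∀ w, ∃ a, w = T a + α w • b := by
  obtain ⟨f, hf, hf'⟩ := Submodule.exists_le_ker_of_notMem (p := LinearMap.range T.toLinearMap)
    (v := b) (by simpa using hb)
  let α : Model (n + 1) →ₗ[ℝ] ℝ := (f b)⁻¹ • f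
  have hαb : α b = 1 := inv_mul_cancel₀ hf
  have hαT : ∀ a, α (T a) = 0 := fun a => by
    have : f (T a) = 0 := hf' ⟨a, rfl⟩
    simp [α, this]
  have hle : LinearMap.range T.toLinearMap ≤ LinearMap.ker α := by
    rintro _ ⟨a, rfl⟩
    exact hαT a
  have hr : Module.finrank ℝ (LinearMap.range T.toLinearMap) = n := by
    rw [LinearMap.finrank_range_of_inj hT, finrank_euclideanSpace_fin]
  have hs : LinearMap.range α = ⊤ :=
    LinearMap.range_eq_top.2 fun c => ⟨c • b, by simp [hαb]⟩
  have hk := α.finrank_range_add_finrank_ker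
  rw [hs, finrank_top, Module.finrank_self, finrank_euclideanSpace_fin] at hk
  -- Both spaces have dimension `n`, so the kernel of `α` is exactly the range of `T`. It contains
  -- `w - α w • b`.
  have heq := Submodule.eq_of_le_of_finrank_eq hle (by omega)
  refine ⟨LinearMap.toContinuousLinearMap α, hαb, hαT, fun w => ?_⟩
  have hw : w - α w • b ∈ LinearMap.range T.toLinearMap := by
    rw [heq, LinearMap.mem_ker, map_sub, map_smul, hαb, smul_eq_mul, mul_one, sub_self]
  obtain ⟨a, ha⟩ := hw
  exact ⟨a, (eq_add_of_sub_eq ha.symm)⟩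

/-! ### Jets -/

section Jets

variable {n N : ℕ}
  {X : Type*} [TopologicalSpace X] [ChartedSpace (Model (n + 1)) X]
  {Y : Type*} [TopologicalSpace Y] [ChartedSpace (Model (n + 1 + N)) Y]
  {S : Type*} [TopologicalSpace S] [ChartedSpace (Model n) S]

variable (n N) in
/-- The derivative of `pr`, in the model spaces. -/
def projDeriv (pr : Y → X) (y : Y) : Model (n + 1 + N) →L[ℝ] Model (n + 1) :=
  mfderiv (𝓡 (n + 1 + N)) (𝓡 (n + 1)) pr y

theorem mem_verticalSpace {pr : Y → X} {y : Y} {v : TangentSpace (𝓡 (n + 1 + N)) y} :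
    v ∈ VerticalSpace n N pr y ↔ projDeriv n N pr y v = 0 := Iff.rfl

/-- Tangent spaces at all points are the same model space, so the transport along `pr y = x` can be
dropped. -/
theorem isJet_iff {pr : Y → X} {x : X} {y : Y}
    {γ : TangentSpace (𝓡 (n + 1)) x →L[ℝ] TangentSpace (𝓡 (n + 1 + N)) y} :
    IsJet n N pr x y γ ↔ pr y = x ∧ ∀ w, projDeriv n N pr y (γ w) = w := by
  constructor
  · rintro ⟨rfl, h⟩
    exact ⟨rfl, h⟩
  · rintro ⟨rfl, h⟩
    exact ⟨rfl, h⟩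

/-- Modification of a jet by a vertical vector and a covector. -/
def jetAdd {x : X} {y : Y}
    (γ : TangentSpace (𝓡 (n + 1)) x →L[ℝ] TangentSpace (𝓡 (n + 1 + N)) y)
    (α : TangentSpace (𝓡 (n + 1)) x →L[ℝ] ℝ) (v : TangentSpace (𝓡 (n + 1 + N)) y) :
    TangentSpace (𝓡 (n + 1)) x →L[ℝ] TangentSpace (𝓡 (n + 1 + N)) y :=
  γ + α.smulRight v

theorem jetAdd_apply {x : X} {y : Y}
    (γ : TangentSpace (𝓡 (n + 1)) x →L[ℝ] TangentSpace (𝓡 (n + 1 + N)) y)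
    (α : TangentSpace (𝓡 (n + 1)) x →L[ℝ] ℝ) (v : TangentSpace (𝓡 (n + 1 + N)) y)
    (w : TangentSpace (𝓡 (n + 1)) x) : jetAdd γ α v w = γ w + α w • v := rfl

theorem isJet_jetAdd {pr : Y → X} {x : X} {y : Y}
    {γ : TangentSpace (𝓡 (n + 1)) x →L[ℝ] TangentSpace (𝓡 (n + 1 + N)) y}
    (h : IsJet n N pr x y γ) (α : TangentSpace (𝓡 (n + 1)) x →L[ℝ] ℝ)
    {v : TangentSpace (𝓡 (n + 1 + N)) y} (hv : v ∈ VerticalSpace n N pr y) :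
    IsJet n N pr x y (jetAdd γ α v) := by
  rw [isJet_iff] at h ⊢
  refine ⟨h.1, fun w => ?_⟩
  have h2 : projDeriv n N pr y (γ w + α w • v) =
    projDeriv n N pr y (γ w) + α w • projDeriv n N pr y v := by
      refine (map_add (projDeriv n N pr y) _ _).trans ?_
      congr 1
      exact map_smul (projDeriv n N pr y) _ _
  rw [jetAdd_apply]
  rw [mem_verticalSpace.1 hv, smul_zero, add_zero] at h2
  exact h2.trans (h.2 w)

theorem IsSection.isJet {ϕ : X → Y} (hpr : ContMDiff (𝓡 (n + 1 + N)) (𝓡 (n + 1)) ∞ pr)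
    (hϕ : IsSection n N pr ϕ) (x : X) :
    IsJet n N pr x (ϕ x) (mfderiv (𝓡 (n + 1)) (𝓡 (n + 1 + N)) ϕ x) := by
  refine isJet_iff.2 ⟨hϕ.2 x, fun w => ?_⟩
  have h1 := mfderiv_comp x (hpr.mdifferentiableAt (x := ϕ x) (by simp))
    (hϕ.1.mdifferentiableAt (by simp))
  have h2 : pr ∘ ϕ = id := funext hϕ.2
  rw [h2, mfderiv_id] at h1
  exact (DFunLike.congr_fun h1 w).symm

variable [IsManifold (𝓡 (n + 1)) ∞ X] [IsManifold (𝓡 (n + 1 + N)) ∞ Y]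

/-- A jet is recovered from its restriction to `Σ_τ` and its time component. -/
theorem jetReconstruction_eq {pr : Y → X} (ζ : ProjectableField n N pr) {τ : S → X} {s : S} {y : Y}
    {α : TangentSpace (𝓡 (n + 1)) (τ s) →L[ℝ] ℝ}
    (hα : ∀ w : TangentSpace (𝓡 (n + 1)) (τ s), ∃ a : TangentSpace (𝓡 n) s,
      w = mfderiv (𝓡 n) (𝓡 (n + 1)) τ s a + α w • ζ.base (τ s))
    {γ : TangentSpace (𝓡 (n + 1)) (τ s) →L[ℝ] TangentSpace (𝓡 (n + 1 + N)) y}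
    (h : IsJet n N pr (τ s) y γ) {κ : TangentSpace (𝓡 n) s →L[ℝ] TangentSpace (𝓡 (n + 1 + N)) y}
    {v : TangentSpace (𝓡 (n + 1 + N)) y}
    (hκ : γ.comp (mfderiv (𝓡 n) (𝓡 (n + 1)) τ s) = κ)
    (hv : γ (ζ.base (τ s)) - ζ.field y = v) :
    jetReconstruction ζ τ s y κ v = γ := by
  subst hκ hv
  have hex : ∃ γ' : TangentSpace (𝓡 (n + 1)) (τ s) →L[ℝ] TangentSpace (𝓡 (n + 1 + N)) y,
      IsJet n N pr (τ s) y γ' ∧ jetDecomposition ζ τ s y γ' = jetDecomposition ζ τ s y γ :=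
    ⟨γ, h, rfl⟩
  -- The chosen jet has the same decomposition as `γ`. Since `ζ_X` and `TΣ_τ` span the tangent
  -- space, the two agree everywhere.
  obtain ⟨-, h2⟩ := Classical.epsilon_spec hex
  change jetDecomposition ζ τ s y (jetReconstruction ζ τ s y _ _) = _ at h2
  set γ' := jetReconstruction ζ τ s y _ _
  have h3 := congrArg Prod.fst h2
  have h4 : γ' (ζ.base (τ s)) = γ (ζ.base (τ s)) := sub_left_injective (congrArg Prod.snd h2)
  ext1 w
  obtain ⟨a, ha⟩ := hα w
  have h5 : γ' (mfderiv (𝓡 n) (𝓡 (n + 1)) τ s a) = γ (mfderiv (𝓡 n) (𝓡 (n + 1)) τ s a) :=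
    DFunLike.congr_fun h3 a
  rw [ha, map_add, map_add, map_smul, map_smul, h4, h5]

/-- A Lagrangian density depends smoothly on the vertical part of the jet. -/
theorem differentiable_lagrangian_jetAdd {pr : Y → X} (𝓛 : LagrangianDensity n N pr) {x : X} {y : Y}
    {γ : TangentSpace (𝓡 (n + 1)) x →L[ℝ] TangentSpace (𝓡 (n + 1 + N)) y}
    (h : IsJet n N pr x y γ) (α : TangentSpace (𝓡 (n + 1)) x →L[ℝ] ℝ)
    (P : TangentSpace (𝓡 (n + 1 + N)) y →L[ℝ] TangentSpace (𝓡 (n + 1 + N)) y)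
    (hP : ∀ v, P v ∈ VerticalSpace n N pr y) (w : Fin (n + 1) → TangentSpace (𝓡 (n + 1)) x) :
    Differentiable ℝ (E := Model (n + 1 + N)) (fun v : TangentSpace (𝓡 (n + 1 + N)) y => 𝓛.toFun x y (jetAdd γ α (P v)) w) := by
  set ey := trivializationAt (Model (n + 1 + N)) (TangentSpace (𝓡 (n + 1 + N))) y
  set ex := trivializationAt (Model (n + 1)) (TangentSpace (𝓡 (n + 1))) x
  have hx : x ∈ ex.baseSet := FiberBundle.mem_baseSet_trivializationAt' x
  have hy : y ∈ ey.baseSet := FiberBundle.mem_baseSet_trivializationAt' y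
  let Cy : Model (n + 1 + N) →L[ℝ] Model (n + 1 + N) := ey.continuousLinearMapAt ℝ y
  let Sx : Model (n + 1) →L[ℝ] Model (n + 1) := ex.symmL ℝ x
  let γ' : Model (n + 1) →L[ℝ] Model (n + 1 + N) := γ
  let α' : Model (n + 1) →L[ℝ] ℝ := α
  let P' : Model (n + 1 + N) →L[ℝ] Model (n + 1 + N) := P
  -- The coordinate matrix of `jetAdd γ α (P v)`. Smoothness of `𝓛` is given only on matrices of
  -- jets; as `P` takes vertical values, `A` maps the whole model space into that set.
  let A : Model (n + 1 + N) → Model (n + 1) →L[ℝ] Model (n + 1 + N) := fun v =>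
    (Cy.comp γ').comp Sx + (α'.comp Sx).smulRight (Cy (P' v))
  have hA : ContDiff ℝ ∞ A :=
    contDiff_const.add (contDiff_const.smulRight (Cy.contDiff.comp P'.contDiff))
  have hjet : ∀ v : TangentSpace (𝓡 (n + 1 + N)) y, jetOfMatrix n N x y x y (A v) = jetAdd γ α (P v) := fun v => by
    ext1 u
    have h1 : ex.symmL ℝ x (ex.continuousLinearMapAt ℝ x u) = u :=
      ex.symmL_continuousLinearMapAt hx u
    have h2 : ∀ u', ey.symmL ℝ y (ey.continuousLinearMapAt ℝ y u') = u' :=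
      ey.symmL_continuousLinearMapAt hy
    have h3 : A v (ex.continuousLinearMapAt ℝ x u) =
        ey.continuousLinearMapAt ℝ y (jetAdd γ α (P v)
          (ex.symmL ℝ x (ex.continuousLinearMapAt ℝ x u))) := by
      rw [jetAdd_apply, map_add, map_smul]
      rfl
    change ey.symmL ℝ y (A v (ex.continuousLinearMapAt ℝ x u)) = _
    rw [h3, h2, h1]
  have hin : ContMDiff 𝓘(ℝ, Model (n + 1 + N)) (((𝓡 (n + 1)).prod (𝓡 (n + 1 + N))).prod
      𝓘(ℝ, Model (n + 1) →L[ℝ] Model (n + 1 + N))) ∞ (fun v => ((x, y), A v)) :=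
    contMDiff_const.prodMk hA.contMDiff
  have hsm := (𝓛.smooth x y).comp_contMDiff hin (fun v =>
    ⟨mem_chart_source _ _, mem_chart_source _ _,
      (congrArg (IsJet n N pr x y) (hjet v)).mpr (isJet_jetAdd h α (hP v))⟩)
  intro v
  have h1 := ((contMDiffAt_totalSpace.1 (hsm v)).2.contDiffAt.differentiableAt (by simp))
  refine DifferentiableAt.congr_of_eventuallyEq
    (h1.continuousAlternatingMap_apply_const (fun j => (ex ⟨x, w j⟩).2))
    (.of_forall fun v' => ?_)
  have h2 := eval_eq_coordinates (mem_chart_source _ x) (𝓛.toFun x y (jetAdd γ α (P v'))) w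
  exact h2.trans (congrArg (fun γ' => (trivializationAt (Model (n + 1) [⋀^Fin (n + 1)]→L[ℝ] ℝ)
    (fun x : X => Form (n + 1) (n + 1) x) x ⟨x, 𝓛.toFun x y γ'⟩).2 (fun j => (ex ⟨x, w j⟩).2))
    (hjet v').symm)

end Jets

/-! ### Linear algebra of the first slot of a form -/

section Interior

variable {V : Type*} [AddCommGroup V] [Module ℝ V] [TopologicalSpace V] {k : ℕ}

theorem interior_apply (v : V) (f : V [⋀^Fin (k + 1)]→L[ℝ] ℝ) (w : Fin k → V) :
    interior v f w = f (Matrix.vecCons v w) := rfl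

theorem interior_add_left (u v : V) (f : V [⋀^Fin (k + 1)]→L[ℝ] ℝ) (w : Fin k → V) :
    interior (u + v) f w = interior u f w + interior v f w :=
  DFunLike.congr_fun (f.toAlternatingMap.curryLeft.map_add u v) w

theorem interior_sub_left (u v : V) (f : V [⋀^Fin (k + 1)]→L[ℝ] ℝ) (w : Fin k → V) :
    interior (u - v) f w = interior u f w - interior v f w :=
  DFunLike.congr_fun (f.toAlternatingMap.curryLeft.map_sub u v) w

end Interior

/-! ### The energy along curves in a fibre of a Legendre transform -/

/-- Along a curve in a fibre of the Legendre transform of `f`, the energy is constant. -/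
theorem legendre_energy_constant {K : Type*} [NormedAddCommGroup K] [NormedSpace ℝ K]
    [FiniteDimensional ℝ K] {f : K → ℝ} (hf : Differentiable ℝ f) (μ : K →ₗ[ℝ] ℝ) {c : ℝ → K}
    (hc : Differentiable ℝ c)
    (h : ∀ t ∈ Set.Icc (0 : ℝ) 1, ∀ v, HasDerivAt (fun ε : ℝ => f (c t + ε • v)) (μ v) 0) :
    μ (c 1) - f (c 1) = μ (c 0) - f (c 0) := by
  have hd : ∀ t ∈ Set.Icc (0 : ℝ) 1, HasDerivAt (fun t => μ (c t) - f (c t)) 0 t := by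
    intro t ht
    have h1 : HasDerivAt (fun t => f (c t)) (fderiv ℝ f (c t) (deriv c t)) t :=
      (hf (c t)).hasFDerivAt.comp_hasDerivAt t (hc t).hasDerivAt
    have h2 : HasDerivAt (fun t => μ (c t)) (μ (deriv c t)) t :=
      (LinearMap.toContinuousLinearMap μ).hasFDerivAt.comp_hasDerivAt t (hc t).hasDerivAt
    -- Being in the fibre means that the differential of `f` at `c t` is `μ`, so the two terms of
    -- the derivative of the energy cancel.
    have h3 : fderiv ℝ f (c t) (deriv c t) = μ (deriv c t) :=
      ((hf (c t)).hasFDerivAt.hasLineDerivAt (deriv c t)).unique (h t ht _)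
    have h4 := h2.sub h1
    rwa [h3, sub_self] at h4
  exact constant_of_has_deriv_right_zero (fun t ht => (hd t ht).continuousAt.continuousWithinAt)
    (fun t ht => (hd t (Ico_subset_Icc_self ht)).hasDerivWithinAt) 1 (right_mem_Icc.2 zero_le_one)

/-! ### The instantaneous Legendre transform -/

section Fields

variable {n N : ℕ}
  {X : Type*} [TopologicalSpace X] [ChartedSpace (Model (n + 1)) X] [IsManifold (𝓡 (n + 1)) ∞ X]
  {Y : Type*} [TopologicalSpace Y] [ChartedSpace (Model (n + 1 + N)) Y]
  [IsManifold (𝓡 (n + 1 + N)) ∞ Y]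
  {S : Type*} [TopologicalSpace S] [ChartedSpace (Model n) S]

/-- `α` is the covector at `τ(s)` with kernel `T_{τ(s)}Σ_τ` and value `1` on `ζ_X`. -/
structure IsTimeCovector {pr : Y → X} (ζ : ProjectableField n N pr) (τ : S → X) (s : S)
    (α : TangentSpace (𝓡 (n + 1)) (τ s) →L[ℝ] ℝ) : Prop where
  base : α (ζ.base (τ s)) = 1
  tangent : ∀ a, α (mfderiv (𝓡 n) (𝓡 (n + 1)) τ s a) = 0
  decompose : ∀ w : TangentSpace (𝓡 (n + 1)) (τ s), ∃ a : TangentSpace (𝓡 n) s,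
    w = mfderiv (𝓡 n) (𝓡 (n + 1)) τ s a + α w • ζ.base (τ s)

theorem exists_isTimeCovector [IsManifold (𝓡 n) ∞ S] {pr : Y → X} {ζ : ProjectableField n N pr}
    {τ : S → X} (hτ : Manifold.IsSmoothEmbedding (𝓡 n) (𝓡 (n + 1)) ∞ τ)
    (hζ : ζ.IsTransverse τ) (s : S) : ∃ α, IsTimeCovector ζ τ s α := by
  obtain ⟨α, h1, h2, h3⟩ := exists_transverse_covector (mfderiv (𝓡 n) (𝓡 (n + 1)) τ s)
    (mfderiv_injective_of_isImmersionAt (hτ.isImmersion.isImmersionAt s)) (hζ s)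
  exact ⟨α, h1, h2, h3⟩

section Pointwise

variable {pr : Y → X} {𝓛 : LagrangianDensity n N pr} {ζ : ProjectableField n N pr}
  {τ : S → X} {s : S} {y : Y} {α : TangentSpace (𝓡 (n + 1)) (τ s) →L[ℝ] ℝ}
  {γ : TangentSpace (𝓡 (n + 1)) (τ s) →L[ℝ] TangentSpace (𝓡 (n + 1 + N)) y}

/-- Adding `α ⊗ v` to `γ` leaves its restriction to `TΣ_τ` unchanged and shifts the velocity by `v`.
This makes the choice in `jetReconstruction` explicit and affine in `v`. -/
theorem splitDensity_eq (hα : IsTimeCovector ζ τ s α) (hγ : IsJet n N pr (τ s) y γ)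
    {κ : TangentSpace (𝓡 n) s →L[ℝ] TangentSpace (𝓡 (n + 1 + N)) y}
    (hκ : γ.comp (mfderiv (𝓡 n) (𝓡 (n + 1)) τ s) = κ)
    {v : TangentSpace (𝓡 (n + 1 + N)) y} (hv : v ∈ VerticalSpace n N pr y)
    (w : Fin n → TangentSpace (𝓡 n) s) :
    splitDensity 𝓛 ζ τ s y κ (γ (ζ.base (τ s)) - ζ.field y + v) w =
      𝓛.toFun (τ s) y (jetAdd γ α v) (Matrix.vecCons (ζ.base (τ s))
        (fun j => mfderiv (𝓡 n) (𝓡 (n + 1)) τ s (w j))) := by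
  have h := jetReconstruction_eq ζ hα.decompose (isJet_jetAdd hγ α hv) (κ := κ)
    (v := γ (ζ.base (τ s)) - ζ.field y + v) (by
      rw [← hκ]
      ext1 a
      rw [ContinuousLinearMap.comp_apply, jetAdd_apply, hα.tangent, zero_smul, add_zero,
        ContinuousLinearMap.comp_apply]) (by
      rw [jetAdd_apply, hα.base, one_smul]
      abel)
  unfold splitDensity
  rw [h]
  rfl

/-- With `γ' = γ` the differentiated function is constant, so its derivative is zero. -/
theorem IsCovariantLegendre.eval_jet {x : X}
    {γ : TangentSpace (𝓡 (n + 1)) x →L[ℝ] TangentSpace (𝓡 (n + 1 + N)) y}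
    {z : Form (n + 1 + N) (n + 1) y}
    (h : IsCovariantLegendre 𝓛 x y γ z) (hγ : IsJet n N pr x y γ)
    (w : Fin (n + 1) → TangentSpace (𝓡 (n + 1)) x) :
    z (fun i => γ (w i)) = 𝓛.toFun x y γ w := by
  have h1 := h.2 γ hγ w
  simp only [sub_self, smul_zero, add_zero] at h1
  exact sub_eq_zero.1 (h1.unique (hasDerivAt_const _ _))

theorem map_vecCons {V W : Type*} (g : V → W) {k : ℕ} (v : V) (w : Fin k → V) :
    (fun i => g (Matrix.vecCons v w i)) = Matrix.vecCons (g v) (fun j => g (w j)) := by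
  funext i
  refine Fin.cases rfl (fun j => rfl) i

/-- The directional form of the statement that the covariant and instantaneous Legendre transforms
agree under `R_τ`; the test jet is `γ + α ⊗ v`. -/
theorem IsCovariantLegendre.hasDerivAt_splitDensity {z : Form (n + 1 + N) (n + 1) y}
    (h : IsCovariantLegendre 𝓛 (τ s) y γ z) (hα : IsTimeCovector ζ τ s α)
    (hγ : IsJet n N pr (τ s) y γ)
    {κ : TangentSpace (𝓡 n) s →L[ℝ] TangentSpace (𝓡 (n + 1 + N)) y}
    (hκ : γ.comp (mfderiv (𝓡 n) (𝓡 (n + 1)) τ s) = κ)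
    {v : TangentSpace (𝓡 (n + 1 + N)) y} (hv : v ∈ VerticalSpace n N pr y)
    (w : Fin n → TangentSpace (𝓡 n) s) :
    HasDerivAt (fun ε : ℝ => splitDensity 𝓛 ζ τ s y κ
      (γ (ζ.base (τ s)) - ζ.field y + ε • v) w) (interior v z (fun j => κ (w j))) 0 := by
  have h1 := h.2 (jetAdd γ α v) (isJet_jetAdd hγ α hv) (Matrix.vecCons (ζ.base (τ s))
    (fun j => mfderiv (𝓡 n) (𝓡 (n + 1)) τ s (w j)))
  have h2 : ∀ ε : ℝ, γ + ε • (jetAdd γ α v - γ) = jetAdd γ α (ε • v) := fun ε => by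
    ext1 u
    rw [_root_.add_apply, _root_.smul_apply,
      _root_.sub_apply, jetAdd_apply, jetAdd_apply, add_sub_cancel_left, smul_comm]
  rw [← h.eval_jet hγ, map_vecCons, map_vecCons] at h1
  -- Since `α` kills `TΣ_τ`, the test jet differs from `γ` in the first slot only, where it adds
  -- `v`.
  simp only [jetAdd_apply, hα.tangent, hα.base, zero_smul, one_smul, add_zero] at h1
  simp only [h2] at h1
  rw [← interior_apply, ← interior_apply, interior_add_left, add_sub_cancel_left] at h1
  subst hκ
  refine h1.congr_of_eventuallyEq (.of_forall fun ε => ?_)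
  exact splitDensity_eq hα hγ rfl (Submodule.smul_mem _ ε hv) w

/-- The Lagrangian term is `i_{γ(ζ_X)} z` by `eval_jet`. It cancels the same term in `i_{φ̇} z`,
leaving the contribution of `ζ_Y`. -/
theorem IsCovariantLegendre.energy_eq {z : Form (n + 1 + N) (n + 1) y}
    (h : IsCovariantLegendre 𝓛 (τ s) y γ z) (hα : IsTimeCovector ζ τ s α)
    (hγ : IsJet n N pr (τ s) y γ)
    {κ : TangentSpace (𝓡 n) s →L[ℝ] TangentSpace (𝓡 (n + 1 + N)) y}
    (hκ : γ.comp (mfderiv (𝓡 n) (𝓡 (n + 1)) τ s) = κ) (w : Fin n → TangentSpace (𝓡 n) s) :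
    interior (γ (ζ.base (τ s)) - ζ.field y) z (fun j => κ (w j)) -
      splitDensity 𝓛 ζ τ s y κ (γ (ζ.base (τ s)) - ζ.field y) w =
      -interior (ζ.field y) z (fun j => κ (w j)) := by
  have h1 := splitDensity_eq (𝓛 := 𝓛) hα hγ hκ (Submodule.zero_mem _) w
  have h2 : jetAdd γ α 0 = γ := by
    ext1 u
    rw [jetAdd_apply, smul_zero, add_zero]
  rw [add_zero, h2, ← h.eval_jet hγ, map_vecCons, ← interior_apply] at h1
  subst hκ
  rw [h1, interior_sub_left]
  simp only [ContinuousLinearMap.comp_apply]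
  ring

/-- The energy density is constant on the curves in a fibre of the Legendre transform. -/
theorem energy_eq_of_curve (hα : IsTimeCovector ζ τ s α) (hγ : IsJet n N pr (τ s) y γ)
    {κ : TangentSpace (𝓡 n) s →L[ℝ] TangentSpace (𝓡 (n + 1 + N)) y}
    (hκ : γ.comp (mfderiv (𝓡 n) (𝓡 (n + 1)) τ s) = κ) (w : Fin n → TangentSpace (𝓡 n) s)
    (μ : VerticalSpace n N pr y →ₗ[ℝ] ℝ) {c : ℝ → VerticalSpace n N pr y}
    (hc : Differentiable ℝ (F := Model (n + 1 + N)) (fun t => (c t).1))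
    (hV : γ (ζ.base (τ s)) - ζ.field y ∈ VerticalSpace n N pr y)
    (h : ∀ t ∈ Set.Icc (0 : ℝ) 1, ∀ v : VerticalSpace n N pr y,
      HasDerivAt (fun ε : ℝ => splitDensity 𝓛 ζ τ s y κ ((c t).1 + ε • v.1) w) (μ v) 0) :
    μ (c 1) - splitDensity 𝓛 ζ τ s y κ (c 1).1 w =
      μ (c 0) - splitDensity 𝓛 ζ τ s y κ (c 0).1 w := by
  let K : Submodule ℝ (Model (n + 1 + N)) := VerticalSpace n N pr y
  let D : TangentSpace (𝓡 (n + 1 + N)) y →L[ℝ] TangentSpace (𝓡 (n + 1)) (τ s) :=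
    projDeriv n N pr y
  have hD : ∀ u, D (γ u) = u := (isJet_iff.1 hγ).2
  -- The projection onto the vertical space along the image of `γ`. It extends the density to all of
  -- `T_yY` and turns `c` into a differentiable curve in the subspace `K`.
  let P : TangentSpace (𝓡 (n + 1 + N)) y →L[ℝ] TangentSpace (𝓡 (n + 1 + N)) y :=
    ContinuousLinearMap.id ℝ _ - γ.comp D
  have hP : ∀ v, P v ∈ VerticalSpace n N pr y := fun v => by
    rw [mem_verticalSpace]
    change D (v - γ (D v)) = 0
    rw [map_sub, hD, sub_self]
  have hP' : ∀ v ∈ VerticalSpace n N pr y, P v = v := fun v hv => by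
    have hv' : D v = 0 := hv
    change v - γ (D v) = v
    rw [hv', map_zero, sub_zero]
  have hdiff := differentiable_lagrangian_jetAdd 𝓛 hγ α P hP (Matrix.vecCons (ζ.base (τ s))
    (fun j => mfderiv (𝓡 n) (𝓡 (n + 1)) τ s (w j)))
  set V₀ := γ (ζ.base (τ s)) - ζ.field y with hV₀
  -- The reference jet `γ` has velocity `V₀`, so velocity `v` corresponds to adding `α ⊗ (v - V₀)`.
  have hsplit : ∀ v : VerticalSpace n N pr y, splitDensity 𝓛 ζ τ s y κ v.1 w =
      𝓛.toFun (τ s) y (jetAdd γ α (P (v.1 - V₀))) (Matrix.vecCons (ζ.base (τ s))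
        (fun j => mfderiv (𝓡 n) (𝓡 (n + 1)) τ s (w j))) := fun v => by
    have h1 := splitDensity_eq (𝓛 := 𝓛) hα hγ hκ (Submodule.sub_mem _ v.2 hV) w
    rw [← hV₀, add_sub_cancel] at h1
    rw [h1, hP' _ (Submodule.sub_mem _ v.2 hV)]
  let f : K → ℝ := fun v => splitDensity 𝓛 ζ τ s y κ v.1 w
  let V₀' : Model (n + 1 + N) := V₀
  have hf : Differentiable ℝ f := by
    have h1 : Differentiable ℝ (fun v : K => (v : Model (n + 1 + N)) - V₀') :=
      K.subtypeL.differentiable.sub (differentiable_const _)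
    have h2 := hdiff.comp h1
    exact (funext hsplit : f = _) ▸ h2
  let PK : Model (n + 1 + N) →L[ℝ] K := ContinuousLinearMap.codRestrict P K hP
  have hcK : Differentiable ℝ (F := K) c := by
    have h1 := PK.differentiable.comp hc
    have h2 : (PK ∘ fun t => (c t).1) = c := funext fun t => Subtype.ext (hP' _ (c t).2)
    rwa [h2] at h1
  exact legendre_energy_constant (K := K) hf μ hcK (fun t ht v => h t ht v)

end Pointwise

end Fields

/-! ### Vector fields along maps -/

section VectorFields

variable {d k : ℕ} {M : Type*} [TopologicalSpace M] [ChartedSpace (Model d) M]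
  [IsManifold (𝓡 d) ∞ M] {S : Type*} [TopologicalSpace S] [ChartedSpace (Model k) S]

theorem contMDiff_sub_along {f : S → M} {U V : ∀ s, TangentSpace (𝓡 d) (f s)}
    (hU : ContMDiff (𝓡 k) (𝓡 d).tangent ∞ (fun s => (⟨f s, U s⟩ : TangentBundle (𝓡 d) M)))
    (hV : ContMDiff (𝓡 k) (𝓡 d).tangent ∞ (fun s => (⟨f s, V s⟩ : TangentBundle (𝓡 d) M))) :
    ContMDiff (𝓡 k) (𝓡 d).tangent ∞
      (fun s => (⟨f s, U s - V s⟩ : TangentBundle (𝓡 d) M)) := by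
  intro s₀
  obtain ⟨hf, hU⟩ := contMDiffAt_totalSpace.1 (hU s₀)
  obtain ⟨-, hV⟩ := contMDiffAt_totalSpace.1 (hV s₀)
  refine contMDiffAt_totalSpace.2 ⟨hf, (hU.sub hV).congr_of_eventuallyEq ?_⟩
  have h1 : ∀ᶠ s in 𝓝 s₀, f s ∈
      (trivializationAt (Model d) (TangentSpace (𝓡 d) : M → Type _) (f s₀)).baseSet :=
    hf.continuousAt.eventually ((trivializationAt (Model d) (TangentSpace (𝓡 d) : M → Type _)
      (f s₀)).open_baseSet.mem_nhds (FiberBundle.mem_baseSet_trivializationAt' _))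
  filter_upwards [h1] with s hs
  exact ((trivializationAt (Model d) (TangentSpace (𝓡 d)) (f s₀)).linear ℝ hs).map_sub _ _

/-- A smooth curve in the tangent bundle, over a fixed point, is a differentiable curve in the
tangent space. -/
theorem differentiable_of_contMDiff_const {y : M} {c : ℝ → TangentSpace (𝓡 d) y}
    (hc : ContMDiff 𝓘(ℝ, ℝ) (𝓡 d).tangent ∞ (fun t => (⟨y, c t⟩ : TangentBundle (𝓡 d) M))) :
    Differentiable ℝ (F := Model d) c := by
  intro t
  set e := trivializationAt (Model d) (TangentSpace (𝓡 d)) y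
  have hy : y ∈ e.baseSet := FiberBundle.mem_baseSet_trivializationAt' y
  have h1 := (contMDiffAt_totalSpace.1 (hc t)).2.contDiffAt.differentiableAt (by simp)
  let L : Model d →L[ℝ] Model d := e.symmL ℝ y
  refine (L.differentiableAt.comp t h1).congr_of_eventuallyEq (.of_forall fun t' => ?_)
  have h2 := e.symmL_continuousLinearMapAt (R := ℝ) hy (c t')
  rw [Trivialization.continuousLinearMapAt_apply, Trivialization.linearMapAt_apply,
    if_pos hy] at h2
  exact h2.symm

/-- The canonical lift of a vector field is a lift. -/
theorem IsCanonicalLift.mfderiv_proj {m : ℕ} {Z : Set (FormBundle d M m)}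
    {ζ : ∀ y : M, TangentSpace (𝓡 d) y}
    {ζZ : ∀ z : FormBundle d M m, TangentSpace (formModel d m) z} (h : IsCanonicalLift d Z ζ ζZ)
    {z : FormBundle d M m} (hz : z ∈ Z) :
    mfderiv (formModel d m) (𝓡 d) (TotalSpace.proj : FormBundle d M m → M) z (ζZ z) =
      ζ z.proj := by
  obtain ⟨θ, hθ, h0, hd⟩ := h z hz
  have h1 : MDifferentiableAt (formModel d m) (𝓡 d) (TotalSpace.proj : FormBundle d M m → M)
      (liftedFlow d θ z 0) :=
    (contMDiff_proj (fun x : M => Form d m x) (n := ∞)).mdifferentiableAt (by simp)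
  -- The lifted flow projects to `θ t z.1`, whose velocity at time `0` is given by `ζ`. Uniqueness
  -- of the derivative compares the two.
  have h2 := h1.hasMFDerivAt.comp 0 hd
  have h3 := hasMFDerivAt_unique h2 hθ.velocity.self_of_nhds
  have h4 : mfderiv (formModel d m) (𝓡 d) (TotalSpace.proj : FormBundle d M m → M)
      (liftedFlow d θ z 0) (ζZ (liftedFlow d θ z 0)) = ζ (liftedFlow d θ z 0).proj := by
    have h5 := DFunLike.congr_fun h3 (1 : ℝ)
    have h6 : (1 : ℝ →L[ℝ] ℝ).smulRight (ζZ (liftedFlow d θ z 0)) (1 : ℝ) =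
      ζZ (liftedFlow d θ z 0) := one_smul ℝ _
    have h7 : (1 : ℝ →L[ℝ] ℝ).smulRight (ζ (θ 0 z.1)) (1 : ℝ) = ζ (θ 0 z.1) := one_smul ℝ _
    exact (congrArg _ h6.symm).trans (h5.trans h7)
  rwa [h0] at h4

end VectorFields

/-! ### The Lie derivative of a section as a point of the Legendre fibre. -/

section Main

variable {n N : ℕ}
  {X : Type*} [TopologicalSpace X] [ChartedSpace (Model (n + 1)) X] [IsManifold (𝓡 (n + 1)) ∞ X]
  {Y : Type*} [TopologicalSpace Y] [ChartedSpace (Model (n + 1 + N)) Y]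
  [IsManifold (𝓡 (n + 1 + N)) ∞ Y]
  {S : Type*} [TopologicalSpace S] [ChartedSpace (Model n) S]
  {pr : Y → X} {𝓛 : LagrangianDensity n N pr} {τ : S → X} {ζ : ProjectableField n N pr}

/-- `Θ` sees vectors only through the projection to `Y`, which takes `ζ_Z` to `ζ_Y` and `Tσ` to
`Tφ`. Continuity of the pulled-back form thus needs no regularity of `ζZ`. -/
theorem pulledBackForm_apply {ζZ : ∀ z : FormBundle (n + 1 + N) Y (n + 1),
      TangentSpace (formModel (n + 1 + N) (n + 1)) z}
    {Z : Set (FormBundle (n + 1 + N) Y (n + 1))} {ξ : ∀ y : Y, TangentSpace (𝓡 (n + 1 + N)) y}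
    (hζZ : IsCanonicalLift (n + 1 + N) Z ξ ζZ)
    {σ : S → FormBundle (n + 1 + N) Y (n + 1)}
    (hσ : ContMDiff (𝓡 n) (formModel (n + 1 + N) (n + 1)) ∞ σ) {s : S} (hs : σ s ∈ Z)
    (w : Fin n → TangentSpace (𝓡 n) s) :
    pulledBackForm ζZ σ s w = interior (ξ (σ s).proj) (σ s).2
      (fun j => mfderiv (𝓡 n) (𝓡 (n + 1 + N)) (fun s => (σ s).proj) s (w j)) := by
  have hproj : ContMDiff (formModel (n + 1 + N) (n + 1)) (𝓡 (n + 1 + N)) ∞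
      (TotalSpace.proj : FormBundle (n + 1 + N) Y (n + 1) → Y) :=
    contMDiff_proj (fun y : Y => Form (n + 1 + N) (n + 1) y)
  have h1 : ∀ u : TangentSpace (𝓡 n) s,
      mfderiv (𝓡 n) (𝓡 (n + 1 + N)) (fun s => (σ s).proj) s u =
        mfderiv (formModel (n + 1 + N) (n + 1)) (𝓡 (n + 1 + N))
          (TotalSpace.proj : FormBundle (n + 1 + N) Y (n + 1) → Y) (σ s)
          (mfderiv (𝓡 n) (formModel (n + 1 + N) (n + 1)) σ s u) := fun u =>
    DFunLike.congr_fun (mfderiv_comp s (hproj.mdifferentiableAt (by simp))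
      (hσ.mdifferentiableAt (by simp))) u
  simp only [h1]
  rw [← hζZ.mfderiv_proj hs, interior_apply, ← map_vecCons]
  rfl

/-- The Lie derivative `Tϕ ∘ ζ_X - ζ_Y ∘ ϕ` of a section `ϕ` along `ζ`. -/
def lieDerivative (ζ : ProjectableField n N pr) (ϕ : X → Y) (x : X) :
    TangentSpace (𝓡 (n + 1 + N)) (ϕ x) :=
  mfderiv (𝓡 (n + 1)) (𝓡 (n + 1 + N)) ϕ x (ζ.base x) - ζ.field (ϕ x)

/-- Both terms project to `ζ_X`: the first because `Tpr ∘ Tϕ = id`, the second because `ζ` is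
projectable. -/
theorem IsSection.lieDerivative_mem {ϕ : X → Y}
    (hpr : ContMDiff (𝓡 (n + 1 + N)) (𝓡 (n + 1)) ∞ pr) (hϕ : IsSection n N pr ϕ) (x : X) :
    lieDerivative ζ ϕ x ∈ VerticalSpace n N pr (ϕ x) := by
  rw [mem_verticalSpace]
  refine (map_sub (projDeriv n N pr (ϕ x)) _ _).trans ?_
  refine sub_eq_zero.2 (((isJet_iff.1 (hϕ.isJet hpr x)).2 _).trans ?_)
  refine Eq.trans ?_ (ζ.project (ϕ x)).symm
  exact congrArg (fun x => (ζ.base x : Model (n + 1))) (hϕ.2 x).symm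

theorem IsSection.contMDiff_lieDerivative {ϕ : X → Y} (hϕ : IsSection n N pr ϕ)
    (hτ : ContMDiff (𝓡 n) (𝓡 (n + 1)) ∞ τ) :
    ContMDiff (𝓡 n) (𝓡 (n + 1 + N)).tangent ∞
      (fun s => (⟨ϕ (τ s), lieDerivative ζ ϕ (τ s)⟩ : TangentBundle (𝓡 (n + 1 + N)) Y)) := by
  have h1 : ContMDiff (𝓡 (n + 1)).tangent (𝓡 (n + 1 + N)).tangent ∞
      (tangentMap (𝓡 (n + 1)) (𝓡 (n + 1 + N)) ϕ) := hϕ.1.contMDiff_tangentMap (by simp)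
  exact contMDiff_sub_along (h1.comp (ζ.smooth_base.comp hτ))
    (ζ.smooth.comp (hϕ.1.comp hτ))

variable [IsManifold (𝓡 n) ∞ S]

theorem IsCovariantLegendre.lieDerivative_mem_legendreFiber {ϕ : X → Y}
    (hpr : ContMDiff (𝓡 (n + 1 + N)) (𝓡 (n + 1)) ∞ pr)
    (hϕ : IsSection n N pr ϕ) (hτ : Manifold.IsSmoothEmbedding (𝓡 n) (𝓡 (n + 1)) ∞ τ)
    (hζ : ζ.IsTransverse τ) {z : ∀ s, Form (n + 1 + N) (n + 1) (ϕ (τ s))}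
    (hz : ∀ s, IsCovariantLegendre 𝓛 (τ s) (ϕ (τ s))
      (mfderiv (𝓡 (n + 1)) (𝓡 (n + 1 + N)) ϕ (τ s)) (z s)) :
    (fun s => ⟨lieDerivative ζ ϕ (τ s), hϕ.lieDerivative_mem hpr (τ s)⟩ :
      ∀ s, VerticalSpace n N pr (ϕ (τ s))) ∈
      legendreFiber 𝓛 ζ τ (reduction pr (fun s => ⟨ϕ (τ s), z s⟩)) := by
  refine ⟨hϕ.contMDiff_lieDerivative hτ.contMDiff, fun s v w => ?_⟩
  obtain ⟨α, hα⟩ := exists_isTimeCovector hτ hζ s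
  exact (hz s).hasDerivAt_splitDensity hα (hϕ.isJet hpr (τ s))
    (mfderiv_comp s (hϕ.1.mdifferentiableAt (by simp))
      (hτ.contMDiff.mdifferentiableAt (by simp))).symm v.2 w

/-- The energy density takes the same value on all elements of the fibre of the Legendre
transform over a momentum with a holonomic lift, and this value is `-φ^*(i_{ζ_Y} σ)`. -/
theorem energyDensity_reduction_apply {ϕ : X → Y}
    (hpr : ContMDiff (𝓡 (n + 1 + N)) (𝓡 (n + 1)) ∞ pr)
    (hϕ : IsSection n N pr ϕ) (hτ : Manifold.IsSmoothEmbedding (𝓡 n) (𝓡 (n + 1)) ∞ τ)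
    (hζ : ζ.IsTransverse τ) (hA : HasConnectedLegendreFibers 𝓛 ζ τ)
    {z : ∀ s, Form (n + 1 + N) (n + 1) (ϕ (τ s))}
    (hz : ∀ s, IsCovariantLegendre 𝓛 (τ s) (ϕ (τ s))
      (mfderiv (𝓡 (n + 1)) (𝓡 (n + 1 + N)) ϕ (τ s)) (z s))
    (hp : reduction pr (fun s => ⟨ϕ (τ s), z s⟩) ∈ primaryConstraintSet 𝓛 ζ τ)
    {V : ∀ s, VerticalSpace n N pr (ϕ (τ s))}
    (hV : V ∈ legendreFiber 𝓛 ζ τ (reduction pr (fun s => ⟨ϕ (τ s), z s⟩)))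
    (s : S) (w : Fin n → TangentSpace (𝓡 n) s) :
    energyDensity 𝓛 ζ τ (reduction pr (fun s => ⟨ϕ (τ s), z s⟩)) V s w =
      -interior (ζ.field (ϕ (τ s))) (z s)
        (fun j => mfderiv (𝓡 n) (𝓡 (n + 1 + N)) (fun s => ϕ (τ s)) s (w j)) := by
  have hV₀ := IsCovariantLegendre.lieDerivative_mem_legendreFiber hpr hϕ hτ hζ hz
  obtain ⟨c, hc, hc0, hc1, hcf⟩ := hA _ hp _ hV₀ _ hV
  obtain ⟨α, hα⟩ := exists_isTimeCovector hτ hζ s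
  have hκ : (mfderiv (𝓡 (n + 1)) (𝓡 (n + 1 + N)) ϕ (τ s)).comp
      (mfderiv (𝓡 n) (𝓡 (n + 1)) τ s) =
        mfderiv (𝓡 n) (𝓡 (n + 1 + N)) (fun s => ϕ (τ s)) s :=
    (mfderiv_comp s (hϕ.1.mdifferentiableAt (by simp))
      (hτ.contMDiff.mdifferentiableAt (by simp))).symm
  have hγ := hϕ.isJet hpr (τ s)
  let P : PhasePoint n N S pr := reduction pr (fun s => ⟨ϕ (τ s), z s⟩)
  -- Fixing the point `s` and the vectors `w` reduces the form-valued momentum to a scalar covector.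
  let μ : VerticalSpace n N pr (ϕ (τ s)) →ₗ[ℝ] ℝ :=
    { toFun v := P.momentum s v w
      map_add' u v := DFunLike.congr_fun ((P.momentum s).map_add u v) w
      map_smul' a v := DFunLike.congr_fun ((P.momentum s).map_smul a v) w }
  have hcs : ContMDiff 𝓘(ℝ, ℝ) (𝓡 (n + 1 + N)).tangent ∞
      (fun t => (⟨ϕ (τ s), (c t s).1⟩ : TangentBundle (𝓡 (n + 1 + N)) Y)) :=
    hc.comp (contMDiff_id.prodMk (contMDiff_const (c := s)))
  have h1 := energy_eq_of_curve (𝓛 := 𝓛) hα hγ hκ w μ (c := fun t => c t s)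
    (differentiable_of_contMDiff_const hcs) (hϕ.lieDerivative_mem hpr (τ s))
    (fun t ht v => (hcf t ht).2 s v w)
  have h2 := (hz s).energy_eq hα hγ hκ w
  simp only [hc0, hc1] at h1
  exact h1.trans h2

end Main

/-! ### Continuity of the local expressions and integration of the energy density. -/

section Continuity

variable {n N : ℕ}
  {Y : Type*} [TopologicalSpace Y] [ChartedSpace (Model (n + 1 + N)) Y]
  [IsManifold (𝓡 (n + 1 + N)) ∞ Y]
  {S : Type*} [TopologicalSpace S] [ChartedSpace (Model n) S] [IsManifold (𝓡 n) ∞ S]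

theorem continuousOn_form_coordFrame {η : ∀ s : S, Form n n s}
    (hη : Continuous (fun s => (⟨s, η s⟩ : FormBundle n S n))) (i : S) :
    ContinuousOn (fun u => η ((extChartAt (𝓡 n) i).symm u) (coordFrame n i u))
      (extChartAt (𝓡 n) i).target := fun _ hu =>
  (continuousAt_eval (hη.continuousAt.comp (continuousAt_extChartAt_symm'' hu))
    (fun j => continuousAt_coordFrame i hu j)).continuousWithinAt

theorem continuousOn_interior_coordFrame {ξ : ∀ y : Y, TangentSpace (𝓡 (n + 1 + N)) y}
    (hξ : Continuous (fun y => (⟨y, ξ y⟩ : TangentBundle (𝓡 (n + 1 + N)) Y))) {φ : S → Y}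
    (hφ : ContMDiff (𝓡 n) (𝓡 (n + 1 + N)) ∞ φ) {z : ∀ s, Form (n + 1 + N) (n + 1) (φ s)}
    (hz : Continuous (fun s => (⟨φ s, z s⟩ : FormBundle (n + 1 + N) Y (n + 1)))) (i : S) :
    ContinuousOn (fun u => interior (ξ (φ ((extChartAt (𝓡 n) i).symm u)))
      (z ((extChartAt (𝓡 n) i).symm u)) (fun j => mfderiv (𝓡 n) (𝓡 (n + 1 + N)) φ
        ((extChartAt (𝓡 n) i).symm u) (coordFrame n i u j))) (extChartAt (𝓡 n) i).target := by
  intro u hu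
  have hc : ContinuousAt (extChartAt (𝓡 n) i).symm u := continuousAt_extChartAt_symm'' hu
  refine (continuousAt_eval (hz.continuousAt.comp hc) (fun j => ?_)).continuousWithinAt
  refine Fin.cases ?_ (fun j => ?_) j
  · exact (hξ.comp hφ.continuous).continuousAt.comp hc
  · exact (hφ.continuous_tangentMap (by simp)).continuousAt.comp (continuousAt_coordFrame i hu j)

theorem continuousOn_pulledBackForm_coordFrame
    {ζZ : ∀ z : FormBundle (n + 1 + N) Y (n + 1), TangentSpace (formModel (n + 1 + N) (n + 1)) z}
    {Z : Set (FormBundle (n + 1 + N) Y (n + 1))} {ξ : ∀ y : Y, TangentSpace (𝓡 (n + 1 + N)) y}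
    (hξ : Continuous (fun y => (⟨y, ξ y⟩ : TangentBundle (𝓡 (n + 1 + N)) Y)))
    (hζZ : IsCanonicalLift (n + 1 + N) Z ξ ζZ)
    {σ : S → FormBundle (n + 1 + N) Y (n + 1)}
    (hσ : ContMDiff (𝓡 n) (formModel (n + 1 + N) (n + 1)) ∞ σ) (hs : ∀ s, σ s ∈ Z) (i : S) :
    ContinuousOn (fun u => pulledBackForm ζZ σ ((extChartAt (𝓡 n) i).symm u) (coordFrame n i u))
      (extChartAt (𝓡 n) i).target :=
  (continuousOn_interior_coordFrame hξ ((contMDiff_proj _).comp hσ) hσ.continuous i).congr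
    fun _ _ => pulledBackForm_apply hζZ hσ (hs _) _

/-- The density identity rewrites the Lagrangian form as `π(φ̇) + η`. Both summands have continuous
local expressions, so the integral splits without a separate study of the Lagrangian form. -/
theorem energy_eq_neg_integralForm [T2Space S] [CompactSpace S]
    {X : Type*} [TopologicalSpace X] [ChartedSpace (Model (n + 1)) X] [IsManifold (𝓡 (n + 1)) ∞ X]
    (o : ManifoldOrientation n S) {pr : Y → X} {𝓛 : LagrangianDensity n N pr}
    {ζ : ProjectableField n N pr} {τ : S → X} {p : PhasePoint n N S pr} (hp : p ∈ phaseSpace pr τ)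
    {V : ∀ s, VerticalSpace n N pr (p.config s)} (hV : V ∈ velocities n N pr p.config)
    {η : ∀ s : S, Form n n s}
    (hη : ∀ i, ContinuousOn (fun u => η ((extChartAt (𝓡 n) i).symm u) (coordFrame n i u))
      (extChartAt (𝓡 n) i).target)
    (h : ∀ s, energyDensity 𝓛 ζ τ p V s = -η s) :
    energy o 𝓛 ζ τ p V = -integralForm n o η := by
  have hL : lagrangianForm 𝓛 ζ τ p.config V = fun s => p.momentum s (V s) + η s := by
    funext s
    have h := h s
    unfold energyDensity at h
    rw [sub_eq_iff_eq_add] at h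
    rw [h]
    abel
  unfold energy pairing instLagrangian
  rw [hL, integralForm_add o (fun i => continuousOn_form_coordFrame (hp.2 V hV).continuous i) hη]
  ring

end Continuity

end FieldTheory

end

open FieldTheory in
theorem proposition6p5 {n N : ℕ}
    {X : Type*} [TopologicalSpace X] [T2Space X] [SecondCountableTopology X]
    [ChartedSpace (Model (n + 1)) X] [IsManifold (𝓡 (n + 1)) ∞ X]
    {Y : Type*} [TopologicalSpace Y] [T2Space Y] [SecondCountableTopology Y]
    [ChartedSpace (Model (n + 1 + N)) Y] [IsManifold (𝓡 (n + 1 + N)) ∞ Y]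
    {F : Type*} [TopologicalSpace F] [ChartedSpace (Model N) F] [IsManifold (𝓡 N) ∞ F]
    {S : Type*} [TopologicalSpace S] [T2Space S] [CompactSpace S]
    [ChartedSpace (Model n) S] [IsManifold (𝓡 n) ∞ S]
    (o : ManifoldOrientation n S)
    (pr : Y → X) (hpr : IsSmoothFiberBundle n N F pr)
    (𝓛 : LagrangianDensity n N pr)
    (τ : S → X) (hτ : Manifold.IsSmoothEmbedding (𝓡 n) (𝓡 (n + 1)) ∞ τ)
    (ζ : ProjectableField n N pr) (hζ : ζ.IsTransverse τ)
    (hA : HasConnectedLegendreFibers 𝓛 ζ τ)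
    (ζZ : ∀ z : FormBundle (n + 1 + N) Y (n + 1),
      TangentSpace (formModel (n + 1 + N) (n + 1)) z)
    (hζZ : IsCanonicalLift (n + 1 + N) (multiphaseSpace n N pr) ζ.field ζZ)
    (p : PhasePoint n N S pr) (hp : p ∈ primaryConstraintSet 𝓛 ζ τ)
    (σ : S → FormBundle (n + 1 + N) Y (n + 1)) (hσ : IsHolonomicLift 𝓛 τ σ p) :
    (∀ s, hamiltonianDensity 𝓛 ζ τ p s = -pulledBackForm ζZ σ s) ∧
    hamiltonian o 𝓛 ζ τ p = -integralForm n o (pulledBackForm ζZ σ) ∧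
    ∀ V ∈ legendreFiber 𝓛 ζ τ p,
      (∀ s, energyDensity 𝓛 ζ τ p V s = hamiltonianDensity 𝓛 ζ τ p s) ∧
      energy o 𝓛 ζ τ p V = hamiltonian o 𝓛 ζ τ p := by

  obtain ⟨⟨⟨hσs, hσZ⟩, ϕ, hϕ, hex⟩, rfl⟩ := hσ
  choose z hz hσz using hex
  obtain rfl : σ = fun s => ⟨ϕ (τ s), z s⟩ := funext hσz
  set p := reduction pr (fun s => (⟨ϕ (τ s), z s⟩ : FormBundle (n + 1 + N) Y (n + 1))) with hpdef
  have hden : ∀ V ∈ legendreFiber 𝓛 ζ τ p, ∀ s,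
      energyDensity 𝓛 ζ τ p V s = -pulledBackForm ζZ (fun s => ⟨ϕ (τ s), z s⟩) s := by
    intro V hV s
    ext w
    rw [energyDensity_reduction_apply hpr.smooth hϕ hτ hζ hA hz hp hV s w,
      ContinuousAlternatingMap.neg_apply, pulledBackForm_apply hζZ hσs (hσZ s).1 w]
  have hen : ∀ V ∈ legendreFiber 𝓛 ζ τ p,
      energy o 𝓛 ζ τ p V = -integralForm n o (pulledBackForm ζZ (fun s => ⟨ϕ (τ s), z s⟩)) := by
    intro V hV
    exact energy_eq_neg_integralForm o hp.1 hV.1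
      (continuousOn_pulledBackForm_coordFrame ζ.smooth.continuous hζZ hσs (fun s => (hσZ s).1))
      (hden V hV)
  -- Membership in the primary constraint set makes the fibre nonempty, so the velocity chosen in
  -- the Hamiltonian lies in it. Independence follows, as every velocity in the fibre gives the same
  -- value.
  have hspec : (Classical.epsilon fun V => V ∈ legendreFiber 𝓛 ζ τ p) ∈ legendreFiber 𝓛 ζ τ p :=
    Classical.epsilon_spec (p := fun V => V ∈ legendreFiber 𝓛 ζ τ p) hp.2
  exact ⟨hden _ hspec, hen _ hspec, fun V hV =>
    ⟨fun s => (hden V hV s).trans (hden _ hspec s).symm, (hen V hV).trans (hen _ hspec).symm⟩⟩
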